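/- Let $(\Omega,\mathcal F,\mathbb P)$ be an atomless probability space, $\mathcal L^\infty$ the set of bounded random variables and $\mathcal L_1$ the set of $[0,1]$-valued random variables on it. "Increasing" is meant in the non-strict sense. A capacity is an increasing $\nu:\mathcal F\to\mathbb R$ with $\nu(\varnothing)=0$ and $\nu(\Omega)=1$; a Choquet risk measure is a mapping $\rho:\mathcal L^\infty\to\mathbb R$ of the form $\rho(X)=\int X\,\mathrm d\nu:=\int_0^\infty \nu(X>x)\,\mathrm dx+\int_{-\infty}^0(\nu(X>x)-1)\,\mathrm dx$ for some capacity $\nu$. A distortion function of $\rho$ is an increasing $h:[0,1]\to\mathbb R$ with $h(0)=0$, $h(1)=1$ and $\rho(X)=\int X\,\mathrm d(h\circ\mathbb P)$ for all $X\in\mathcal L^\infty$. Let $n\ge 2$. A rating criterion is a mapping $\mathcal I:\mathcal L_1\to\{1,\dots,n\}$ with $\mathcal I(X)\le\mathcal I(Y)$ whenever $X\le Y$. It is a Choquet rating criterion if there are a Choquet risk measure $\rho_{\mathcal I}$ and an increasing $f:[0,1]\to\{1,\dots,n\}$ with $f(0)=1$, $f(1)=n$, not constant on $(0,1)$, such that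 $\mathcal I(X)=f(\rho_{\mathcal I}(X))$ for all $X\in\mathcal L_1$. Let $\mathcal I$ be a Choquet rating criterion represented in this way by a Choquet risk measure $\rho_{\mathcal I}$, and suppose that $\mathcal I$ satisfies - [LI] (law invariance): $\mathcal I(X)=\mathcal I(Y)$ for all $X,Y\in\mathcal L_1$ with the same distribution under $\mathbb P$; and - [LS] (lower semi-continuity): $\liminf_{k\to\infty}\mathcal I(X_k)\ge\mathcal I(X)$ for all $X,X_1,X_2,\dots\in\mathcal L_1$ with $X_k\to X$ almost surely. Then the following are equivalent: (i) [QC] $\mathcal I(\lambda X+(1-\lambda)Y)\le\max\{\mathcal I(X),\mathcal I(Y)\}$ for all $X,Y\in\mathcal L_1$ and $\lambda\in[0,1]$; (ii) [RA] $\mathcal I(X)\le\mathcal I(Y)$ for all $X,Y\in\mathcal L_1$ such that $\mathbb E[\phi(X)]\le\mathbb E[\phi(Y)]$ for every increasing convex function $\phi:\mathbb R\to\mathbb R$; (iii) [PE] for every sequence $L_1,L_2,\dots$ in $\mathcal L_1$ that is conditionally iid given some (finite-dimensional) random vector $Z$, all integers $1\le\ell\le\ell'$ and all $K\in[0,1)$,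 $$\mathcal I\left(\frac{(L^{(\ell)}-K)_+}{1-K}\right)\ge\mathcal I\left(\frac{(L^{(\ell')}-K)_+}{1-K}\right),\qquad L^{(m)}=\frac{L_1+\dots+L_m}{m};$$ (iv) $\rho_{\mathcal I}$ has a distortion function that is concave on $[0,1]$. -/

import Mathlib

open MeasureTheory ProbabilityTheory Filter Topology

namespace ChoquetRating

/-- A measure is atomless (in the measure-theoretic sense) if every event of positive measure
contains an event of strictly smaller positive measure. -/
def Atomless {Ω : Type*} [MeasurableSpace Ω] (P : Measure Ω) : Prop :=
  ∀ A : Set Ω, MeasurableSet A → 0 < P A →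
    ∃ B : Set Ω, MeasurableSet B ∧ B ⊆ A ∧ 0 < P B ∧ P B < P A

/-- The space `𝓛^∞` of bounded random variables. -/
def BoundedRV (Ω : Type*) [MeasurableSpace Ω] : Type _ :=
  {X : Ω → ℝ // Measurable X ∧ ∃ C : ℝ, ∀ ω, |X ω| ≤ C}

/-- The space `𝓛₁` of random losses, that is, random variables with values in `[0,1]`. -/
def Loss (Ω : Type*) [MeasurableSpace Ω] : Type _ :=
  {X : Ω → ℝ // Measurable X ∧ ∀ ω, X ω ∈ Set.Icc (0 : ℝ) 1}

instance {Ω : Type*} [MeasurableSpace Ω] : CoeFun (BoundedRV Ω) (fun _ => Ω → ℝ) :=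
  ⟨Subtype.val⟩

instance {Ω : Type*} [MeasurableSpace Ω] : CoeFun (Loss Ω) (fun _ => Ω → ℝ) :=
  ⟨Subtype.val⟩

/-- The inclusion of `𝓛₁` into `𝓛^∞`. -/
def Loss.toBounded {Ω : Type*} [MeasurableSpace Ω] (X : Loss Ω) : BoundedRV Ω :=
  ⟨X.1, X.2.1, 1, fun ω => abs_le.2 ⟨by linarith [(X.2.2 ω).1], (X.2.2 ω).2⟩⟩

/-- The convex combination `t X + (1 - t) Y` of two losses. -/
def Loss.mix {Ω : Type*} [MeasurableSpace Ω] (t : Set.Icc (0 : ℝ) 1) (X Y : Loss Ω) : Loss Ω :=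
  ⟨fun ω => (t : ℝ) * X ω + (1 - (t : ℝ)) * Y ω,
    (X.2.1.const_mul _).add (Y.2.1.const_mul _), fun ω =>
      (convex_Icc (0 : ℝ) 1) (X.2.2 ω) (Y.2.2 ω) t.2.1 (sub_nonneg.2 t.2.2) (by ring)⟩

/-- The average `(L 0 + ⋯ + L (ℓ - 1)) / ℓ` of the first `ℓ` terms of a sequence of losses. -/
noncomputable def poolAverage {Ω : Type*} [MeasurableSpace Ω] (L : ℕ → Loss Ω) (ℓ : ℕ)
    (ω : Ω) : ℝ :=
  (∑ i ∈ Finset.range ℓ, L i ω) / ℓ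

theorem poolAverage_measurable {Ω : Type*} [MeasurableSpace Ω] (L : ℕ → Loss Ω) (ℓ : ℕ) :
    Measurable (poolAverage L ℓ) :=
  (Finset.measurable_fun_sum _ fun i _ => (L i).2.1).div_const _

theorem poolAverage_le_one {Ω : Type*} [MeasurableSpace Ω] (L : ℕ → Loss Ω) (ℓ : ℕ) (ω : Ω) :
    poolAverage L ℓ ω ≤ 1 := by
  refine div_le_one_of_le₀ ?_ (Nat.cast_nonneg ℓ)
  calc ∑ i ∈ Finset.range ℓ, L i ω ≤ ∑ _i ∈ Finset.range ℓ, (1 : ℝ) :=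
        Finset.sum_le_sum fun i _ => ((L i).2.2 ω).2
    _ = ℓ := by simp

/-- The normalized loss `(L^(ℓ) - K)₊ / (1 - K)` of the senior tranche with attachment point
`K ∈ [0,1)`, where `L^(ℓ)` is the average of the first `ℓ` losses. -/
noncomputable def seniorTranche {Ω : Type*} [MeasurableSpace Ω] (L : ℕ → Loss Ω)
    (K : Set.Ico (0 : ℝ) 1) (ℓ : ℕ) : Loss Ω :=
  ⟨fun ω => max (poolAverage L ℓ ω - K) 0 / (1 - K),
    (((poolAverage_measurable L ℓ).sub_const _).max measurable_const).div_const _, fun ω => by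
      have hK : (0 : ℝ) < 1 - K := sub_pos.2 K.2.2
      refine ⟨div_nonneg (le_max_right _ _) hK.le, (div_le_one hK).2 (max_le ?_ hK.le)⟩
      linarith [poolAverage_le_one L ℓ ω]⟩

/-- Capacities: increasing functions of events, with value `0` at `∅` and `1` at `Ω`. (Only the
values at measurable sets matter.) -/
structure IsCapacity {Ω : Type*} [MeasurableSpace Ω] (ν : Set Ω → ℝ) : Prop where
  mono : ∀ A B : Set Ω, MeasurableSet A → MeasurableSet B → A ⊆ B → ν A ≤ ν B
  empty : ν ∅ = 0
  univ : ν Set.univ = 1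

/-- The Choquet integral
`∫ X dν = ∫_0^∞ ν(X > x) dx + ∫_{-∞}^0 (ν(X > x) - 1) dx`. For a capacity `ν` and bounded
measurable `X` both integrands are monotone with bounded support, hence integrable. -/
noncomputable def choquetIntegral {Ω : Type*} (ν : Set Ω → ℝ) (X : Ω → ℝ) : ℝ :=
  (∫ x in Set.Ioi (0 : ℝ), ν {ω | x < X ω}) + ∫ x in Set.Iio (0 : ℝ), (ν {ω | x < X ω} - 1)

/-- Choquet risk measures on `𝓛^∞`. -/
def IsChoquetRiskMeasure {Ω : Type*} [MeasurableSpace Ω] (ρ : BoundedRV Ω → ℝ) : Prop :=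
  ∃ ν : Set Ω → ℝ, IsCapacity ν ∧ ∀ X : BoundedRV Ω, ρ X = choquetIntegral ν X

/-- `h : [0,1] → ℝ` is a distortion function of `ρ`: it is increasing on `[0,1]`, `h 0 = 0`,
`h 1 = 1`, and `ρ(X) = ∫ X d(h ∘ P)` for all bounded `X`. -/
structure IsDistortionFunction {Ω : Type*} [MeasurableSpace Ω] (P : Measure Ω) (h : ℝ → ℝ)
    (ρ : BoundedRV Ω → ℝ) : Prop where
  mono : MonotoneOn h (Set.Icc 0 1)
  zero : h 0 = 0
  one : h 1 = 1
  eq_integral : ∀ X : BoundedRV Ω, ρ X = choquetIntegral (fun A => h (P.real A)) X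

/-- A rating criterion with rating categories `1, …, n`, where `n ≥ 2`. -/
structure IsRatingCriterion {Ω : Type*} [MeasurableSpace Ω] (n : ℕ) (I : Loss Ω → ℕ) :
    Prop where
  two_le : 2 ≤ n
  mem : ∀ X : Loss Ω, I X ∈ Set.Icc 1 n
  mono : ∀ X Y : Loss Ω, (∀ ω, X ω ≤ Y ω) → I X ≤ I Y

/-- An increasing function `f : [0,1] → {1, …, n}` with `f 0 = 1` and `f 1 = n`. -/
structure IsGrid (n : ℕ) (f : ℝ → ℕ) : Prop where
  mem : ∀ x ∈ Set.Icc (0 : ℝ) 1, f x ∈ Set.Icc 1 n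
  mono : MonotoneOn f (Set.Icc 0 1)
  zero : f 0 = 1
  one : f 1 = n

/-- The rating criterion `I` is a Choquet rating criterion, represented by the Choquet risk
measure `ρ`: `I = f ∘ ρ` on `𝓛₁` for some grid function `f` that is not constant on `(0,1)`. -/
def IsChoquetRatingCriterion {Ω : Type*} [MeasurableSpace Ω] (n : ℕ) (I : Loss Ω → ℕ)
    (ρ : BoundedRV Ω → ℝ) : Prop :=
  IsRatingCriterion n I ∧ IsChoquetRiskMeasure ρ ∧
    ∃ f : ℝ → ℕ, IsGrid n f ∧ (∃ x ∈ Set.Ioo (0 : ℝ) 1, ∃ y ∈ Set.Ioo (0 : ℝ) 1, f x ≠ f y) ∧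
      ∀ X : Loss Ω, I X = f (ρ X.toBounded)

/-- [LI], law invariance. -/
def LawInvariant {Ω : Type*} [MeasurableSpace Ω] (P : Measure Ω) (I : Loss Ω → ℕ) : Prop :=
  ∀ X Y : Loss Ω, IdentDistrib X Y P P → I X = I Y

/-- [LS], lower semi-continuity under almost sure convergence. -/
def LowerSemicontinuousAS {Ω : Type*} [MeasurableSpace Ω] (P : Measure Ω) (I : Loss Ω → ℕ) :
    Prop :=
  ∀ (X : ℕ → Loss Ω) (Y : Loss Ω),
    (∀ᵐ ω ∂P, Tendsto (fun k => X k ω) atTop (𝓝 (Y ω))) →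
      I Y ≤ liminf (fun k => I (X k)) atTop

/-- [QC], quasi-convexity. -/
def QuasiConvex {Ω : Type*} [MeasurableSpace Ω] (I : Loss Ω → ℕ) : Prop :=
  ∀ (X Y : Loss Ω) (t : Set.Icc (0 : ℝ) 1), I (Loss.mix t X Y) ≤ max (I X) (I Y)

/-- Increasing convex order: `E[φ(X)] ≤ E[φ(Y)]` for all increasing convex `φ : ℝ → ℝ`. -/
def IcxLE {Ω : Type*} [MeasurableSpace Ω] (P : Measure Ω) (X Y : BoundedRV Ω) : Prop :=
  ∀ φ : ℝ → ℝ, Monotone φ → ConvexOn ℝ Set.univ φ → ∫ ω, φ (X ω) ∂P ≤ ∫ ω, φ (Y ω) ∂P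

/-- [RA], risk aversion consistency. -/
def RiskAverse {Ω : Type*} [MeasurableSpace Ω] (P : Measure Ω) (I : Loss Ω → ℕ) : Prop :=
  ∀ X Y : Loss Ω, IcxLE P X.toBounded Y.toBounded → I X ≤ I Y

/-- The sequence `L` is iid conditionally on the random vector `Z`: given `σ(Z)`, its terms are
independent and have the same conditional distribution. -/
structure CondIIDGiven {Ω : Type*} [MeasurableSpace Ω] (P : Measure Ω) (L : ℕ → Loss Ω)
    {d : ℕ} (Z : Ω → Fin d → ℝ) : Prop where
  measurable : Measurable Z
  indep : ∀ (s : Finset ℕ) (A : ℕ → Set ℝ), (∀ i ∈ s, MeasurableSet (A i)) →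
    P⟦⋂ i ∈ s, (L i : Ω → ℝ) ⁻¹' A i | MeasurableSpace.comap Z inferInstance⟧
      =ᵐ[P] ∏ i ∈ s, P⟦(L i : Ω → ℝ) ⁻¹' A i | MeasurableSpace.comap Z inferInstance⟧
  ident : ∀ (i j : ℕ) (A : Set ℝ), MeasurableSet A →
    P⟦(L i : Ω → ℝ) ⁻¹' A | MeasurableSpace.comap Z inferInstance⟧
      =ᵐ[P] P⟦(L j : Ω → ℝ) ⁻¹' A | MeasurableSpace.comap Z inferInstance⟧

/-- Conditionally iid sequences of losses. -/
def CondIID {Ω : Type*} [MeasurableSpace Ω] (P : Measure Ω) (L : ℕ → Loss Ω) : Prop :=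
  ∃ (d : ℕ) (Z : Ω → Fin d → ℝ), CondIIDGiven P L Z

/-- [PE], pooling effect consistency. -/
def PoolingConsistent {Ω : Type*} [MeasurableSpace Ω] (P : Measure Ω) (I : Loss Ω → ℕ) :
    Prop :=
  ∀ L : ℕ → Loss Ω, CondIID P L → ∀ ℓ ℓ' : ℕ, 1 ≤ ℓ → ℓ ≤ ℓ' → ∀ K : Set.Ico (0 : ℝ) 1,
    I (seniorTranche L K ℓ') ≤ I (seniorTranche L K ℓ)

end ChoquetRating

/-! The grid function is non-constant on `(0,1)`, so together with [LS] it yields a level `c` in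
`(0,1)` and a category `k` such that `I X ≤ k` exactly when the Choquet integral of `X` is at most
`c` (`exists_threshold`). A loss `b + a 1_A` has Choquet integral `b + a ν(A)`, and `b`, `a` can be
tuned so that this equals `c`. One rating boundary therefore detects every comparison between values
of `ν`: [LI] forces `ν = h ∘ P` on events (`exists_distortion`), and [LS] makes `h` left-continuous.

Both [QC] with [LI] and [PE] imply that averaging two conditionally iid losses does not worsen the
rating. Applied to conditionally iid events of probability `r`, with intersection of probability `r
- η` and union of probability `r + η`, this says `h (r - η) + h (r + η) ≤ 2 * h r`. Small `η` and
left continuity suffice for concavity (`concaveOn_of_local_midpoint`).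

Conversely, a concave `h` is a limit of nonnegative combinations of `t ↦ min t α`. For the latter,
the distorted integral of `X` is the minimum over `x` of `(α - 1) x + E[max X x]`, an
expected-shortfall formula. It shows convexity in `X` and monotonicity in increasing convex order at
once, giving [QC] and [RA]. Finally [RA] implies [PE]: by exchangeability and Jensen, pool averages
decrease in convex order as the pool grows. -/

namespace ChoquetRating

/-! ### Atomless spaces: intermediate values and independent fair coins. -/

section Atomless

variable {Ω : Type*} [MeasurableSpace Ω] {P : Measure Ω} [IsProbabilityMeasure P]

theorem Atomless.exists_subset_measureReal_pos_le (hP : Atomless P) {A : Set Ω}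
    (hA : MeasurableSet A) (hpos : 0 < P.real A) (n : ℕ) :
    ∃ B, MeasurableSet B ∧ B ⊆ A ∧ 0 < P.real B ∧ P.real B ≤ P.real A / 2 ^ n := by
  induction n with
  | zero => exact ⟨A, hA, subset_rfl, hpos, by simp⟩
  | succ n ih =>
    obtain ⟨B, hB, hBA, hB0, hBn⟩ := ih
    obtain ⟨C, hC, hCB, hC0, hC1⟩ := hP B hB (ENNReal.toReal_pos_iff.1 hB0).1
    have h0 : 0 < P.real C := by
      rw [Measure.real]; exact ENNReal.toReal_pos hC0.ne' (measure_ne_top _ _)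
    have h1 : P.real C < P.real B :=
      (ENNReal.toReal_lt_toReal (measure_ne_top _ _) (measure_ne_top _ _)).2 hC1
    have h2 : P.real (B \ C) = P.real B - P.real C := measureReal_sdiff hCB hC
    have h3 : P.real A / 2 ^ (n + 1) = P.real A / 2 ^ n / 2 := by rw [pow_succ]; field_simp
    -- One of `C` and `B \ C` carries at most half of the mass of `B`.
    by_cases h : P.real C ≤ P.real B / 2
    · exact ⟨C, hC, hCB.trans hBA, h0, by linarith⟩
    · exact ⟨B \ C, hB.diff hC, Set.sdiff_subset.trans hBA, by linarith, by linarith⟩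

/-- The greedy step for Sierpiński's theorem. The supremum of the admissible masses need not visibly
be attained, but more than half of it is, unless it vanishes. -/
theorem exists_subset_diff_almost_maximal (P : Measure Ω) [IsProbabilityMeasure P]
    {A B : Set Ω} {t : ℝ} (ht : P.real B ≤ t) :
    ∃ C, MeasurableSet C ∧ C ⊆ A \ B ∧ P.real C ≤ t - P.real B ∧
      ∀ D, MeasurableSet D → D ⊆ A \ B → P.real D ≤ t - P.real B → P.real D ≤ 2 * P.real C := by
  set S : Set ℝ := {x | ∃ C, MeasurableSet C ∧ C ⊆ A \ B ∧ P.real C ≤ t - P.real B ∧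
    P.real C = x} with hS
  have hbdd : BddAbove S := ⟨1, by rintro x ⟨C, -, -, -, rfl⟩; exact measureReal_le_one⟩
  have hle : ∀ D, MeasurableSet D → D ⊆ A \ B → P.real D ≤ t - P.real B → P.real D ≤ sSup S :=
    fun D h1 h2 h3 => le_csSup hbdd ⟨D, h1, h2, h3, rfl⟩
  by_cases h : 0 < sSup S
  · obtain ⟨x, ⟨C, h1, h2, h3, rfl⟩, hx⟩ :=
      exists_lt_of_lt_csSup (s := S) ⟨P.real ∅, ∅, MeasurableSet.empty, Set.empty_subset _, by simpa, rfl⟩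
        (half_lt_self h)
    exact ⟨C, h1, h2, h3, fun D h4 h5 h6 => by linarith [hle D h4 h5 h6]⟩
  · exact ⟨∅, MeasurableSet.empty, Set.empty_subset _, by simpa, fun D h4 h5 h6 => by
      simpa using (hle D h4 h5 h6).trans (not_lt.1 h)⟩

/-- Sierpiński's theorem: an atomless measure takes all intermediate values. -/
theorem Atomless.exists_subset_measureReal_eq (hP : Atomless P) {A : Set Ω}
    (hA : MeasurableSet A) {t : ℝ} (h0 : 0 ≤ t) (ht : t ≤ P.real A) :
    ∃ B, MeasurableSet B ∧ B ⊆ A ∧ P.real B = t := by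
  let T := {B : Set Ω // MeasurableSet B ∧ B ⊆ A ∧ P.real B ≤ t}
  choose f hf1 hf2 hf3 hf4 using
    fun B : T => exists_subset_diff_almost_maximal P (A := A) (B := B.1) B.2.2.2
  have hfun : ∀ B : T, P.real (B.1 ∪ f B) = P.real B.1 + P.real (f B) := fun B =>
    measureReal_union (Set.disjoint_sdiff_right.mono_right (hf2 B)) (hf1 B)
  let step : T → T := fun B => ⟨B.1 ∪ f B, B.2.1.union (hf1 B),
    Set.union_subset B.2.2.1 ((hf2 B).trans Set.sdiff_subset), by
      rw [hfun]; linarith [hf3 B]⟩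
  let u : ℕ → T := fun n => step^[n] ⟨∅, MeasurableSet.empty, Set.empty_subset _, by simpa⟩
  have hu : ∀ n, (u (n + 1)).1 = (u n).1 ∪ f (u n) := fun n => by
    simp only [u, Function.iterate_succ_apply']; rfl
  have hmono : Monotone fun n => (u n).1 := monotone_nat_of_le_succ fun n => by
    rw [hu]; exact Set.subset_union_left
  set B := ⋃ n, (u n).1 with hB
  have hBm : MeasurableSet B := MeasurableSet.iUnion fun n => (u n).2.1
  have hBA : B ⊆ A := Set.iUnion_subset fun n => (u n).2.2.1
  have hlim : Tendsto (fun n => P.real (u n).1) atTop (𝓝 (P.real B)) :=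
    (ENNReal.tendsto_toReal (measure_ne_top _ _)).comp (tendsto_measure_iUnion_atTop hmono)
  have hBt : P.real B ≤ t := le_of_tendsto' hlim fun n => (u n).2.2.2
  refine ⟨B, hBm, hBA, hBt.antisymm ?_⟩
  -- If the greedy union misses `t`, some set `C` of positive mass still fits at every stage, so
  -- each stage gains at least half of `P.real C`; the total would exceed 1.
  by_contra! hlt
  have hd : P.real (A \ B) = P.real A - P.real B := measureReal_sdiff hBA hBm
  obtain ⟨n, hn⟩ := pow_unbounded_of_one_lt (P.real (A \ B) / (t - P.real B)) one_lt_two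
  obtain ⟨C, hC, hCA, hC0, hCn⟩ := hP.exists_subset_measureReal_pos_le (hA.diff hBm)
    (by linarith) n
  have hCt : P.real C ≤ t - P.real B := by
    refine hCn.trans ?_
    rw [div_lt_iff₀ (by linarith)] at hn
    rw [div_le_iff₀ (by positivity)]; linarith
  have hgrow : ∀ n : ℕ, n * (P.real C / 2) ≤ P.real (u n).1 := by
    intro n
    induction n with
    | zero => simp
    | succ n ih =>
      have hsub : (u n).1 ⊆ B := Set.subset_iUnion (fun n => (u n).1) n
      have h1 := hf4 (u n) C hC (hCA.trans (Set.sdiff_subset_sdiff_right hsub))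
        (by linarith [measureReal_mono (μ := P) hsub])
      rw [hu, hfun]; push_cast; linarith
  obtain ⟨m, hm⟩ := exists_nat_gt (1 / (P.real C / 2))
  rw [div_lt_iff₀ (by linarith)] at hm
  linarith [hgrow m, measureReal_le_one (μ := P) (s := (u m).1)]

/-- A fair coin which is independent of a given integer-valued random variable. -/
theorem Atomless.exists_fair_coin (hP : Atomless P) {g : Ω → ℕ} (hg : Measurable g) :
    ∃ ε : Ω → Bool, Measurable ε ∧
      ∀ (V : Set ℕ) (b : Bool), P.real (g ⁻¹' V ∩ ε ⁻¹' {b}) = P.real (g ⁻¹' V) / 2 := by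
  have hcell : ∀ k : ℕ, MeasurableSet (g ⁻¹' {k}) := fun k => hg (measurableSet_singleton k)
  -- Each level set of `g` is cut into halves; the coin shows heads on the union of the chosen
  -- halves.
  choose E hE hEs hEP using fun k => hP.exists_subset_measureReal_eq (hcell k)
    (t := P.real (g ⁻¹' {k}) / 2) (by positivity) (half_le_self measureReal_nonneg)
  classical
  have hmeas : MeasurableSet (⋃ k, E k) := MeasurableSet.iUnion hE
  have hmeas' : MeasurableSet {ω | ω ∈ ⋃ k, E k} := hmeas
  have key : ∀ V : Set ℕ, P.real (g ⁻¹' V ∩ ⋃ k, E k) = P.real (g ⁻¹' V) / 2 := by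
    intro V
    have h1 : g ⁻¹' V ∩ ⋃ k, E k = ⋃ k : V, E k := by
      ext ω
      simp only [Set.mem_inter_iff, Set.mem_preimage, Set.mem_iUnion]
      constructor
      · rintro ⟨h, k, hk⟩
        have : g ω = k := hEs k hk
        exact ⟨⟨k, this ▸ h⟩, hk⟩
      · rintro ⟨k, hk⟩
        have : g ω = k := hEs k hk
        exact ⟨this ▸ k.2, k, hk⟩
    have h2 : g ⁻¹' V = ⋃ k : V, g ⁻¹' {k.1} := by ext ω; simp
    have hdis : Pairwise (Function.onFun Disjoint fun k : V => g ⁻¹' {k.1}) := fun i j hij =>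
      Disjoint.preimage _ (by simpa using fun h => hij (Subtype.ext h))
    have e1 : P (g ⁻¹' V ∩ ⋃ k, E k) = ∑' k : V, P (E k) := by
      rw [h1, measure_iUnion (fun i j hij => (hdis hij).mono (hEs _) (hEs _)) fun k => hE k]
    have e2 : P (g ⁻¹' V) = ∑' k : V, P (g ⁻¹' {k.1}) := by
      conv_lhs => rw [h2]
      rw [measure_iUnion hdis fun k => hcell k]
    have e3 : ∀ k, P (g ⁻¹' {k}) = 2 * P (E k) := fun k => by
      rw [← ENNReal.toReal_eq_toReal_iff' (measure_ne_top _ _) (by finiteness),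
        ENNReal.toReal_mul]
      have := hEP k
      simp only [Measure.real] at this
      rw [this]; simp; ring
    simp_rw [e3] at e2
    rw [ENNReal.tsum_mul_left, ← e1] at e2
    rw [Measure.real, Measure.real, e2, ENNReal.toReal_mul]; simp
  refine ⟨fun ω => decide (ω ∈ ⋃ k, E k), measurable_to_bool (by
    convert hmeas using 1; ext ω; simp), fun V b => ?_⟩
  have ht : (fun ω => decide (ω ∈ ⋃ k, E k)) ⁻¹' {true} = ⋃ k, E k := by ext ω; simp
  have hf : (fun ω => decide (ω ∈ ⋃ k, E k)) ⁻¹' {false} = (⋃ k, E k)ᶜ := by ext ω; simp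
  cases b with
  | true => rw [ht, key]
  | false =>
    rw [hf, ← Set.sdiff_eq]
    have := measureReal_inter_add_sdiff (μ := P) (s := g ⁻¹' V) hmeas
    rw [key] at this; linarith

/-- The probability that a fair coin falls into `S`. -/
noncomputable def coinProb (S : Set Bool) : ℝ := (S.indicator 1 true + S.indicator 1 false) / 2

/-- A sequence of independent fair coins which is independent of a given random variable with
finitely many values. -/
theorem Atomless.exists_fair_coins (hP : Atomless P) {π : Ω → Fin 3} (hπ : Measurable π) :
    ∃ ε : ℕ → Ω → Bool, (∀ i, Measurable (ε i)) ∧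
      ∀ (s : Finset ℕ) (z : Fin 3) (S : ℕ → Set Bool),
        P.real (π ⁻¹' {z} ∩ ⋂ i ∈ s, ε i ⁻¹' S i) =
          P.real (π ⁻¹' {z}) * ∏ i ∈ s, coinProb (S i) := by
  let T := {g : Ω → ℕ // Measurable g}
  choose coin hcm hcP using fun g : T => hP.exists_fair_coin g.2
  -- The whole history, `π` followed by the coins so far, is kept in one integer by appending binary
  -- digits. Each new coin is independent of that integer, hence of the history.
  let step : T → T := fun g => ⟨fun ω => 2 * g.1 ω + (coin g ω).toNat,
    (g.2.const_mul 2).add ((measurable_of_finite Bool.toNat).comp (hcm g))⟩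
  let u : ℕ → T := fun n => step^[n] ⟨fun ω => (π ω : ℕ), (measurable_of_finite _).comp hπ⟩
  have hu : ∀ n ω, (u (n + 1)).1 ω = 2 * (u n).1 ω + (coin (u n) ω).toNat := fun n ω => by
    simp only [u, Function.iterate_succ_apply']; rfl
  have hu1 : ∀ n ω, (u n).1 ω = (u (n + 1)).1 ω / 2 := fun n ω => by
    rw [hu]; cases coin (u n) ω <;> simp; omega
  have hu2 : ∀ n ω, coin (u n) ω = decide ((u (n + 1)).1 ω % 2 = 1) := fun n ω => by
    rw [hu]; cases coin (u n) ω <;> simp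
  refine ⟨fun n => coin (u n), fun n => hcm _, ?_⟩
  have hrange : ∀ (N : ℕ) (z : Fin 3) (S : ℕ → Set Bool),
      (∃ V : Set ℕ, (π ⁻¹' {z} ∩ ⋂ i ∈ Finset.range N, coin (u i) ⁻¹' S i) = (u N).1 ⁻¹' V) ∧
      P.real (π ⁻¹' {z} ∩ ⋂ i ∈ Finset.range N, coin (u i) ⁻¹' S i) =
          P.real (π ⁻¹' {z}) * ∏ i ∈ Finset.range N, coinProb (S i) := by
    intro N z S
    induction N with
    | zero =>
      refine ⟨⟨{(z : ℕ)}, ?_⟩, by simp⟩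
      ext ω; simp [u, Fin.ext_iff]
    | succ N ih =>
      obtain ⟨⟨V, hV⟩, hprod⟩ := ih
      have hset : (π ⁻¹' {z} ∩ ⋂ i ∈ Finset.range (N + 1), coin (u i) ⁻¹' S i) =
          (u N).1 ⁻¹' V ∩ coin (u N) ⁻¹' S N := by
        rw [← hV, Finset.range_add_one, Finset.set_biInter_insert]
        ext ω; simp only [Set.mem_inter_iff]; tauto
      refine ⟨⟨{k | k / 2 ∈ V ∧ decide (k % 2 = 1) ∈ S N}, ?_⟩, ?_⟩
      · rw [hset]
        ext ω
        simp only [Set.mem_inter_iff, Set.mem_preimage, Set.mem_ofPred_eq, ← hu1, ← hu2]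
      · rw [hset, Finset.prod_range_succ, ← mul_assoc, ← hprod, hV]
        have h1 := hcP (u N) V true
        have h2 := hcP (u N) V false
        have hsplit : (u N).1 ⁻¹' V ∩ coin (u N) ⁻¹' S N =
            ((u N).1 ⁻¹' V ∩ coin (u N) ⁻¹' (S N ∩ {true})) ∪
              ((u N).1 ⁻¹' V ∩ coin (u N) ⁻¹' (S N ∩ {false})) := by
          ext ω
          simp only [Set.mem_inter_iff, Set.mem_preimage, Set.mem_union, Set.mem_singleton_iff]
          cases coin (u N) ω <;> simp
        have hdis : Disjoint ((u N).1 ⁻¹' V ∩ coin (u N) ⁻¹' (S N ∩ {true}))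
            ((u N).1 ⁻¹' V ∩ coin (u N) ⁻¹' (S N ∩ {false})) := by
          rw [Set.disjoint_left]
          rintro ω ⟨-, -, h⟩ ⟨-, -, h'⟩
          simp only [Set.mem_singleton_iff] at h h'
          simp [h] at h'
        rw [hsplit, measureReal_union hdis (((u N).2 (Set.to_countable V).measurableSet).inter
          (hcm _ (Set.toFinite _).measurableSet))]
        have hb : ∀ b, P.real ((u N).1 ⁻¹' V ∩ coin (u N) ⁻¹' (S N ∩ {b})) =
            P.real ((u N).1 ⁻¹' V) / 2 * (S N).indicator 1 b := by
          intro b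
          by_cases hb : b ∈ S N
          · rw [Set.inter_eq_right.2 (Set.singleton_subset_iff.2 hb), hcP]; simp [hb]
          · rw [Set.inter_singleton_eq_empty.2 hb]; simp [hb]
        rw [hb, hb, coinProb]; ring
  intro s z S
  classical
  obtain ⟨N, hN⟩ := s.exists_nat_subset_range
  -- Indices outside `s` are padded with the full set, whose `coinProb` is 1.
  have h := (hrange N z fun i => if i ∈ s then S i else Set.univ).2
  have hset : (⋂ i ∈ Finset.range N, coin (u i) ⁻¹' (if i ∈ s then S i else Set.univ)) =
      ⋂ i ∈ s, coin (u i) ⁻¹' S i := by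
    ext ω
    simp only [Set.mem_iInter, Set.mem_preimage]
    constructor
    · intro h i hi
      simpa [hi] using h i (hN hi)
    · intro h i _
      by_cases hi : i ∈ s
      · simpa [hi] using h i hi
      · simp [hi]
  rw [hset] at h
  rw [h]
  congr 1
  rw [← Finset.prod_subset hN]
  · exact Finset.prod_congr rfl fun i hi => by simp [hi]
  · intro i _ hi
    simp [hi, coinProb]

end Atomless

/-! ### Conditionally iid sequences: construction from coins, exchangeability, convex ordering of
averages. -/

section CondIID

variable {Ω : Type*} [MeasurableSpace Ω] {P : Measure Ω} [IsProbabilityMeasure P]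

/-- Since `q` is injective, `Z` and `π` generate the same finite partition. On a cell the losses are
a fixed function of the independent coins, so the conditional probability is a product depending
only on the cell. -/
theorem condExp_iInter_of_coins {π : Ω → Fin 3} (hπ : Measurable π) {ε : ℕ → Ω → Bool}
    (hind : ∀ (s : Finset ℕ) (z : Fin 3) (S : ℕ → Set Bool),
        P.real (π ⁻¹' {z} ∩ ⋂ i ∈ s, ε i ⁻¹' S i) =
          P.real (π ⁻¹' {z}) * ∏ i ∈ s, coinProb (S i))
    (F : Fin 3 → Bool → ℝ) (L : ℕ → Loss Ω) (hL : ∀ i ω, L i ω = F (π ω) (ε i ω))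
    {d : ℕ} {Z : Ω → Fin d → ℝ} (hZ : Measurable Z) {q : Fin 3 → Fin d → ℝ}
    (hq : Function.Injective q) (hZq : ∀ ω, Z ω = q (π ω))
    (s : Finset ℕ) (A : ℕ → Set ℝ) (hA : ∀ i ∈ s, MeasurableSet (A i)) :
    P⟦⋂ i ∈ s, (L i : Ω → ℝ) ⁻¹' A i | MeasurableSpace.comap Z inferInstance⟧
      =ᵐ[P] fun ω => ∏ i ∈ s, coinProb (F (π ω) ⁻¹' A i) := by
  set C := ⋂ i ∈ s, (L i : Ω → ℝ) ⁻¹' A i with hC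
  have hCm : MeasurableSet C := Finset.measurableSet_biInter _ fun i hi => (L i).2.1 (hA i hi)
  set G : Fin 3 → ℝ := fun z => ∏ i ∈ s, coinProb (F z ⁻¹' A i) with hG
  have hπZ : Measurable[MeasurableSpace.comap Z inferInstance] π := by
    refine @measurable_to_countable' _ _ _ _ (MeasurableSpace.comap Z inferInstance) _ fun z => ?_
    refine ⟨{q z}, measurableSet_singleton _, ?_⟩
    ext ω; simp [hZq, hq.eq_iff]
  have hGint : Integrable (fun ω => G (π ω)) P := by
    obtain ⟨M, hM⟩ := (Set.finite_range fun z => ‖G z‖).bddAbove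
    exact Integrable.of_bound ((measurable_of_finite G).comp hπ).aestronglyMeasurable M
      (Eventually.of_forall fun ω => hM ⟨π ω, rfl⟩)
  have hcell : ∀ z, P.real (π ⁻¹' {z} ∩ C) = P.real (π ⁻¹' {z}) * G z := by
    intro z
    rw [hG, ← hind s z fun i => F z ⁻¹' A i]
    congr 1
    ext ω
    simp only [hC, Set.mem_inter_iff, Set.mem_iInter, Set.mem_preimage, Set.mem_singleton_iff, hL]
    exact and_congr_right fun h => by rw [h]
  refine (ae_eq_condExp_of_forall_setIntegral_eq hZ.comap_le
    ((integrable_const 1).indicator hCm) (fun _ _ _ => hGint.integrableOn) ?_ ?_).symm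
  · rintro _ ⟨T, hT, rfl⟩ -
    have hTV : Z ⁻¹' T = π ⁻¹' (q ⁻¹' T) := by ext ω; simp [hZq]
    have hTm : MeasurableSet (Z ⁻¹' T) := hZ hT
    have e1 : ∫ ω in Z ⁻¹' T, G (π ω) ∂P
        = ∑ z, P.real (π ⁻¹' {z}) * (q ⁻¹' T).indicator G z := by
      have h1 : ∀ ω, (Z ⁻¹' T).indicator (fun ω => G (π ω)) ω =
          ((q ⁻¹' T).indicator G) (π ω) := fun ω => by
        rw [hTV]; rfl
      rw [← integral_indicator hTm]
      simp_rw [h1]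
      rw [← integral_map (f := (q ⁻¹' T).indicator G) hπ.aemeasurable
        (measurable_of_finite _).aestronglyMeasurable, integral_fintype (Integrable.of_finite)]
      refine Finset.sum_congr rfl fun z _ => ?_
      rw [map_measureReal_apply hπ (measurableSet_singleton z), smul_eq_mul]
    have e2 : ∫ ω in Z ⁻¹' T, C.indicator (fun _ => (1 : ℝ)) ω ∂P =
        ∑ z, P.real (π ⁻¹' {z}) * (q ⁻¹' T).indicator G z := by
      rw [integral_indicator hCm, Measure.restrict_restrict hCm]
      simp only [integral_const, MeasurableSet.univ, measureReal_restrict_apply, Set.univ_inter,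
        smul_eq_mul, mul_one]
      have h := sum_measureReal_preimage_singleton (μ := P.restrict (C ∩ Z ⁻¹' T))
        (f := π) Finset.univ (fun z _ => hπ (measurableSet_singleton z))
      rw [Finset.coe_univ, Set.preimage_univ, measureReal_restrict_apply MeasurableSet.univ,
        Set.univ_inter] at h
      rw [← h]
      refine Finset.sum_congr rfl fun z _ => ?_
      rw [measureReal_restrict_apply (hπ (measurableSet_singleton z))]
      by_cases hz : q z ∈ T
      · rw [Set.indicator_of_mem (by exact hz), ← hcell]
        congr 1
        ext ω
        simp only [hTV, Set.mem_inter_iff, Set.mem_preimage, Set.mem_singleton_iff]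
        constructor
        · rintro ⟨h, h', -⟩; exact ⟨h, h'⟩
        · rintro ⟨h, h'⟩; exact ⟨h, h', h ▸ hz⟩
      · rw [Set.indicator_of_notMem (by exact hz), mul_zero]
        convert measureReal_empty
        ext ω
        simp only [hTV, Set.mem_inter_iff, Set.mem_preimage, Set.mem_singleton_iff,
          Set.mem_empty_iff_false, iff_false]
        rintro ⟨h, -, h'⟩; exact hz (h ▸ h')
    rw [e1, e2]
  · exact ((measurable_of_finite G).comp hπZ).aestronglyMeasurable

theorem condIID_of_coins {π : Ω → Fin 3} (hπ : Measurable π) {ε : ℕ → Ω → Bool}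
    (hind : ∀ (s : Finset ℕ) (z : Fin 3) (S : ℕ → Set Bool),
        P.real (π ⁻¹' {z} ∩ ⋂ i ∈ s, ε i ⁻¹' S i) =
          P.real (π ⁻¹' {z}) * ∏ i ∈ s, coinProb (S i))
    (F : Fin 3 → Bool → ℝ) (L : ℕ → Loss Ω) (hL : ∀ i ω, L i ω = F (π ω) (ε i ω)) :
    CondIID P L := by
  let q : Fin 3 → Fin 1 → ℝ := fun z _ => ((z : ℕ) : ℝ)
  have hq : Function.Injective q := fun x y h => by
    have := congrFun h 0
    simpa [q, Fin.ext_iff] using this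
  have hZ : Measurable fun ω => q (π ω) := (measurable_of_finite q).comp hπ
  have key := condExp_iInter_of_coins hπ hind F L hL hZ hq fun _ => rfl
  have one : ∀ (i : ℕ) (A : Set ℝ), MeasurableSet A →
      P⟦(L i : Ω → ℝ) ⁻¹' A | MeasurableSpace.comap (fun ω => q (π ω)) inferInstance⟧
        =ᵐ[P] fun ω => coinProb (F (π ω) ⁻¹' A) := fun i A hA => by
    simpa using key {i} (fun _ => A) fun _ _ => hA
  refine ⟨1, fun ω => q (π ω), hZ, fun s A hA => (key s A hA).trans ?_, fun i j A hA =>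
    (one i A hA).trans (one j A hA).symm⟩
  have hall : ∀ᵐ ω ∂P, ∀ i ∈ s, (P⟦(L i : Ω → ℝ) ⁻¹' A i |
      MeasurableSpace.comap (fun ω => q (π ω)) inferInstance⟧) ω =
        coinProb (F (π ω) ⁻¹' A i) :=
    (ae_ball_iff s.countable_toSet).2 fun i hi => one i (A i) (hA i hi)
  filter_upwards [hall] with ω hω
  rw [Finset.prod_apply]
  exact (Finset.prod_congr rfl hω).symm

/-- The point is that the right-hand side does not involve `σ`: conditional independence factors the
probability and identical conditional laws replace every factor by one for `L 0`. -/
theorem CondIIDGiven.measureReal_iInter {L : ℕ → Loss Ω} {d : ℕ} {Z : Ω → Fin d → ℝ}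
    (h : CondIIDGiven P L Z) {m : ℕ} {σ : Fin m → ℕ} (hσ : Function.Injective σ)
    (A : Fin m → Set ℝ) (hA : ∀ k, MeasurableSet (A k)) :
    P.real (⋂ k, (L (σ k) : Ω → ℝ) ⁻¹' A k) =
      ∫ ω, ∏ k, (P⟦(L 0 : Ω → ℝ) ⁻¹' A k | MeasurableSpace.comap Z inferInstance⟧) ω ∂P := by
  set A' : ℕ → Set ℝ := Function.extend σ A fun _ => Set.univ with hA'
  have hA'σ : ∀ k, A' (σ k) = A k := fun k => hσ.extend_apply _ _ _
  set C := ⋂ k, (L (σ k) : Ω → ℝ) ⁻¹' A k with hC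
  have hCm : MeasurableSet C := MeasurableSet.iInter fun k => (L (σ k)).2.1 (hA k)
  have hset : C = ⋂ i ∈ Finset.univ.image σ, (L i : Ω → ℝ) ⁻¹' A' i := by
    ext ω; simp [hC, hA'σ]
  have hind := h.indep (Finset.univ.image σ) A' (by
    simp only [Finset.mem_image, Finset.mem_univ, true_and]
    rintro _ ⟨k, rfl⟩; rw [hA'σ]; exact hA k)
  rw [← hset, Finset.prod_image fun i _ j _ hij => hσ hij] at hind
  have h1 : P.real C =
      ∫ ω, (P⟦C | MeasurableSpace.comap Z inferInstance⟧) ω ∂P := by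
    rw [integral_condExp h.measurable.comap_le, integral_indicator hCm]; simp
  rw [h1]
  refine integral_congr_ae ?_
  have hall : ∀ᵐ ω ∂P, ∀ k : Fin m, (P⟦(L (σ k) : Ω → ℝ) ⁻¹' A k |
      MeasurableSpace.comap Z inferInstance⟧) ω =
        (P⟦(L 0 : Ω → ℝ) ⁻¹' A k | MeasurableSpace.comap Z inferInstance⟧) ω :=
    ae_all_iff.2 fun k => h.ident _ _ _ (hA k)
  filter_upwards [hind, hall] with ω h2 h3
  rw [h2, Finset.prod_apply]
  exact Finset.prod_congr rfl fun k _ => by rw [hA'σ]; exact h3 k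

/-- Conditionally iid sequences are exchangeable. -/
theorem CondIIDGiven.map_eq {L : ℕ → Loss Ω} {d : ℕ} {Z : Ω → Fin d → ℝ}
    (h : CondIIDGiven P L Z) {m : ℕ} {σ τ : Fin m → ℕ} (hσ : Function.Injective σ)
    (hτ : Function.Injective τ) :
    P.map (fun ω k => L (σ k) ω) = P.map (fun ω k => L (τ k) ω) := by
  have hm : ∀ σ : Fin m → ℕ, Measurable fun ω k => L (σ k) ω := fun σ =>
    measurable_pi_lambda _ fun k => (L (σ k)).2.1
  have : IsProbabilityMeasure (P.map fun ω k => L (σ k) ω) :=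
    Measure.isProbabilityMeasure_map (hm σ).aemeasurable
  have : IsProbabilityMeasure (P.map fun ω k => L (τ k) ω) :=
    Measure.isProbabilityMeasure_map (hm τ).aemeasurable
  refine ext_of_generate_finite _ generateFrom_pi.symm isPiSystem_pi ?_ (by simp)
  rintro _ ⟨A, hA, rfl⟩
  have hA' : ∀ k, MeasurableSet (A k) := fun k => hA k (Set.mem_univ k)
  have hbox : ∀ σ : Fin m → ℕ, (fun ω k => L (σ k) ω) ⁻¹' Set.univ.pi A =
      ⋂ k, (L (σ k) : Ω → ℝ) ⁻¹' A k := fun σ => by ext ω; simp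
  rw [Measure.map_apply (hm σ) (MeasurableSet.univ_pi hA'),
    Measure.map_apply (hm τ) (MeasurableSet.univ_pi hA'), hbox, hbox]
  refine (ENNReal.toReal_eq_toReal_iff' (measure_ne_top _ _) (measure_ne_top _ _)).1 ?_
  exact (h.measureReal_iInter hσ A hA').trans (h.measureReal_iInter hτ A hA').symm

theorem integrable_of_continuous_of_mem_Icc {ψ : ℝ → ℝ} (hψ : Continuous ψ) {X : Ω → ℝ}
    (hX : Measurable X) (h01 : ∀ ω, X ω ∈ Set.Icc (0 : ℝ) 1) :
    Integrable (fun ω => ψ (X ω)) P := by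
  obtain ⟨C, hC⟩ := isCompact_Icc.exists_bound_of_continuousOn (hψ.continuousOn (s := Set.Icc 0 1))
  exact Integrable.of_bound (hψ.measurable.comp hX).aestronglyMeasurable C
    (Eventually.of_forall fun ω => hC _ (h01 ω))

theorem poolAverage_mem_Icc (L : ℕ → Loss Ω) (ℓ : ℕ) (ω : Ω) :
    poolAverage L ℓ ω ∈ Set.Icc (0 : ℝ) 1 :=
  ⟨div_nonneg (Finset.sum_nonneg fun i _ => ((L i).2.2 ω).1) (Nat.cast_nonneg _),
    poolAverage_le_one L ℓ ω⟩

/-- The average of `m + 1` losses is the mean of its `m + 1` leave-one-out averages. Each of these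
has the law of the average of the first `m` losses by exchangeability, so Jensen's inequality
applies. -/
theorem CondIIDGiven.integral_convex_poolAverage_succ_le {L : ℕ → Loss Ω} {d : ℕ}
    {Z : Ω → Fin d → ℝ} (h : CondIIDGiven P L Z) {ψ : ℝ → ℝ} (hψ : ConvexOn ℝ Set.univ ψ)
    {m : ℕ} (hm : 1 ≤ m) :
    ∫ ω, ψ (poolAverage L (m + 1) ω) ∂P ≤ ∫ ω, ψ (poolAverage L m ω) ∂P := by
  have hc : Continuous ψ := continuousOn_univ.1 (hψ.continuousOn isOpen_univ)
  have hm0 : (m : ℝ) ≠ 0 := by positivity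
  let M : (Fin m → ℕ) → Ω → ℝ := fun σ ω => (∑ k, L (σ k) ω) / m
  have hMm : ∀ σ, Measurable (M σ) := fun σ =>
    (Finset.measurable_fun_sum _ fun k _ => (L (σ k)).2.1).div_const _
  have hM01 : ∀ σ ω, M σ ω ∈ Set.Icc (0 : ℝ) 1 := fun σ ω => by
    refine ⟨div_nonneg (Finset.sum_nonneg fun i _ => ((L _).2.2 ω).1) (Nat.cast_nonneg _),
      div_le_one_of_le₀ ?_ (Nat.cast_nonneg m)⟩
    calc ∑ k, L (σ k) ω ≤ ∑ _k : Fin m, (1 : ℝ) := Finset.sum_le_sum fun i _ => ((L _).2.2 ω).2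
      _ = m := by simp
  have hMint : ∀ σ, Integrable (fun ω => ψ (M σ ω)) P := fun σ =>
    integrable_of_continuous_of_mem_Icc hc (hMm σ) (hM01 σ)
  have hlaw : ∀ σ : Fin m → ℕ, Function.Injective σ →
      ∫ ω, ψ (M σ ω) ∂P = ∫ ω, ψ (poolAverage L m ω) ∂P := by
    intro σ hσ
    have hg : Continuous fun x : Fin m → ℝ => ψ ((∑ k, x k) / m) := by fun_prop
    have e : ∀ τ : Fin m → ℕ, ∫ ω, ψ (M τ ω) ∂P =
        ∫ x, ψ ((∑ k, x k) / m) ∂(P.map fun ω k => L (τ k) ω) := fun τ => by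
      rw [integral_map (measurable_pi_lambda _ fun k => (L (τ k)).2.1).aemeasurable
        hg.aestronglyMeasurable]
    rw [e σ, h.map_eq hσ (Fin.val_injective (n := m)), ← e]
    simp only [M, poolAverage, Finset.sum_range]
  -- `σ j` lists the indices up to `m` with `j` omitted.
  let σ : Fin (m + 1) → Fin m → ℕ := fun j k => (j.succAbove k : ℕ)
  have hσ : ∀ j, Function.Injective (σ j) := fun j =>
    Fin.val_injective.comp Fin.succAbove_right_injective
  have havg : ∀ ω, poolAverage L (m + 1) ω = ∑ j, ((m + 1 : ℝ)⁻¹) • M (σ j) ω := by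
    intro ω
    have h1 : ∀ j : Fin (m + 1), ∑ k, L (σ j k) ω = (∑ i : Fin (m + 1), L i ω) - L j ω :=
      fun j => by rw [Fin.sum_univ_succAbove _ j]; simp [σ]
    simp only [poolAverage, M, h1, Finset.sum_range, smul_eq_mul]
    rw [← Finset.mul_sum, ← Finset.sum_div, Finset.sum_sub_distrib]
    simp only [Finset.sum_const, Finset.card_univ, Fintype.card_fin, nsmul_eq_mul]
    push_cast
    have : (m + 1 : ℝ) ≠ 0 := by positivity
    field_simp
    ring
  have hpt : ∀ ω, ψ (poolAverage L (m + 1) ω) ≤ ∑ j, ((m + 1 : ℝ)⁻¹) * ψ (M (σ j) ω) := by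
    intro ω
    rw [havg]
    refine hψ.map_sum_le (fun _ _ => by positivity) ?_ fun _ _ => Set.mem_univ _
    have : (m + 1 : ℝ) ≠ 0 := by positivity
    simp [this]
  calc ∫ ω, ψ (poolAverage L (m + 1) ω) ∂P
      ≤ ∫ ω, ∑ j, ((m + 1 : ℝ)⁻¹) * ψ (M (σ j) ω) ∂P :=
        integral_mono (integrable_of_continuous_of_mem_Icc hc (poolAverage_measurable L _)
          (poolAverage_mem_Icc L _)) (integrable_finsetSum _ fun j _ => (hMint _).const_mul _) hpt
    _ = ∫ ω, ψ (poolAverage L m ω) ∂P := by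
        rw [integral_finsetSum _ fun j _ => (hMint _).const_mul _]
        simp_rw [integral_const_mul, hlaw _ (hσ _)]
        have : (m + 1 : ℝ) ≠ 0 := by positivity
        simp [this]

theorem CondIIDGiven.integral_convex_poolAverage_antitone {L : ℕ → Loss Ω} {d : ℕ}
    {Z : Ω → Fin d → ℝ} (h : CondIIDGiven P L Z) {ψ : ℝ → ℝ} (hψ : ConvexOn ℝ Set.univ ψ)
    {m m' : ℕ} (hm : 1 ≤ m) (hmm' : m ≤ m') :
    ∫ ω, ψ (poolAverage L m' ω) ∂P ≤ ∫ ω, ψ (poolAverage L m ω) ∂P := by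
  induction m', hmm' using Nat.le_induction with
  | base => exact le_rfl
  | succ k hk ih => exact (h.integral_convex_poolAverage_succ_le hψ (hm.trans hk)).trans ih

/-- The tranche payoff is convex in the pool average, hence so is its composition with an increasing
convex test function. -/
theorem RiskAverse.poolingConsistent {I : Loss Ω → ℕ} (hI : RiskAverse P I) :
    PoolingConsistent P I := by
  rintro L ⟨d, Z, hZ⟩ ℓ ℓ' hℓ hℓℓ' K
  refine hI _ _ fun φ hφ hφc => ?_
  have hK : (0 : ℝ) < 1 - K := sub_pos.2 K.2.2
  have hg : ConvexOn ℝ Set.univ fun x : ℝ => max (x - K) 0 / (1 - K) := by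
    have h1 : ConvexOn ℝ Set.univ fun x : ℝ => max (x - K) 0 :=
      ((convexOn_id convex_univ).sub (concaveOn_const (K : ℝ) convex_univ)).sup
        (convexOn_const 0 convex_univ)
    have h2 := h1.smul (inv_pos.2 hK).le
    refine h2.congr fun x _ => ?_
    simp [div_eq_inv_mul]
  have hψ : ConvexOn ℝ Set.univ fun x : ℝ => φ (max (x - K) 0 / (1 - K)) :=
    ⟨convex_univ, fun x hx y hy a b ha hb hab => (hφ (hg.2 hx hy ha hb hab)).trans
      (hφc.2 (Set.mem_univ _) (Set.mem_univ _) ha hb hab)⟩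
  exact hZ.integral_convex_poolAverage_antitone hψ hℓ hℓℓ'

end CondIID

/-! ### Concave distortions as limits of combinations of `t ↦ min t a`. -/

section ConcaveApproximation

/-- A concave increasing function on `[0,1]` that vanishes at `0` is the pointwise limit from below
of nonnegative combinations of the functions `t ↦ min t a` with `a ∈ [0,1]`. -/
theorem exists_min_combination_tendsto {h : ℝ → ℝ} (hmono : MonotoneOn h (Set.Icc 0 1))
    (h0 : h 0 = 0) (hc : ConcaveOn ℝ (Set.Icc 0 1) h) :
    ∃ c : ℕ → ℕ → ℝ, (∀ m i, i < m → 0 ≤ c m i) ∧ ∀ t ∈ Set.Icc (0 : ℝ) 1,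
      (∀ m : ℕ, ∑ i ∈ Finset.range m, c m i * min t ((i + 1 : ℝ) / m) ≤ h t) ∧
      Tendsto (fun m : ℕ => ∑ i ∈ Finset.range m, c m i * min t ((i + 1 : ℝ) / m)) atTop
        (𝓝 (h t)) := by
  -- Slopes of the piecewise linear interpolation of `h` on the grid of mesh `1 / m`. The
  -- coefficients sought are the successive drops in slope: nonnegative by concavity, and for the
  -- last one, where the default 0 enters, by monotonicity.
  let d : ℕ → ℕ → ℝ := fun m i => if i < m then m * (h ((i + 1 : ℝ) / m) - h ((i : ℝ) / m)) else 0
  have hmem : ∀ m i : ℕ, i ≤ m → (i : ℝ) / m ∈ Set.Icc (0 : ℝ) 1 := fun m i hi =>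
    ⟨by positivity, div_le_one_of_le₀ (by exact_mod_cast hi) (Nat.cast_nonneg m)⟩
  have hmem' : ∀ m i : ℕ, i < m → (i + 1 : ℝ) / m ∈ Set.Icc (0 : ℝ) 1 := fun m i hi => by
    simpa using hmem m (i + 1) hi
  have hd0 : ∀ m i, 0 ≤ d m i := by
    intro m i
    simp only [d]
    split_ifs with hi
    · refine mul_nonneg (Nat.cast_nonneg m) (sub_nonneg.2 (hmono (hmem m i hi.le) (hmem' m i hi) ?_))
      gcongr; linarith
    · exact le_rfl
  have hdanti : ∀ m i, i < m → 0 ≤ d m i - d m (i + 1) := by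
    intro m i hi
    by_cases hi' : i + 1 < m
    · have h2 := hc.2 (hmem m i hi.le) (hmem' m (i + 1) hi')
        (show (0 : ℝ) ≤ 1 / 2 by norm_num) (show (0 : ℝ) ≤ 1 / 2 by norm_num) (by norm_num)
      have h3 : (1 / 2 : ℝ) • ((i : ℝ) / m) + (1 / 2 : ℝ) • (((i + 1 : ℕ) + 1 : ℝ) / m) =
          (i + 1 : ℝ) / m := by push_cast; simp only [smul_eq_mul]; ring
      rw [h3] at h2
      simp only [smul_eq_mul] at h2
      simp only [d, hi, hi', if_true]
      rw [← mul_sub]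
      refine mul_nonneg (Nat.cast_nonneg m) ?_
      push_cast at h2 ⊢
      linarith
    · have : d m (i + 1) = 0 := by simp [d, hi']
      rw [this, sub_zero]; exact hd0 m i
  -- Summation by parts identifies the combination with the interpolation at `t`.
  have habel : ∀ (m : ℕ) {t : ℝ}, 0 ≤ t →
      ∑ i ∈ Finset.range m, (d m i - d m (i + 1)) * min t ((i + 1 : ℝ) / m) =
        ∑ i ∈ Finset.range m, d m i * (min t ((i + 1 : ℝ) / m) - min t ((i : ℝ) / m)) := by
    intro m t ht
    have key : ∀ k : ℕ, ∑ i ∈ Finset.range k, (d m i - d m (i + 1)) * min t ((i + 1 : ℝ) / m) =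
        ∑ i ∈ Finset.range k, d m i * (min t ((i + 1 : ℝ) / m) - min t ((i : ℝ) / m))
          - d m k * min t ((k : ℝ) / m) := by
      intro k
      induction k with
      | zero => simp [ht]
      | succ k ih => rw [Finset.sum_range_succ, Finset.sum_range_succ, ih]; push_cast; ring
    have hdm : d m m = 0 := by simp [d]
    rw [key m, hdm, zero_mul, sub_zero]
  have hupper : ∀ (m : ℕ) {t : ℝ}, t ∈ Set.Icc (0 : ℝ) 1 → ∀ i < m,
      d m i * (min t ((i + 1 : ℝ) / m) - min t ((i : ℝ) / m)) ≤
        h (min t ((i + 1 : ℝ) / m)) - h (min t ((i : ℝ) / m)) := by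
    intro m t ht i hi
    have hm : (0 : ℝ) < m := by exact_mod_cast (Nat.zero_le i).trans_lt hi
    have hd : d m i = m * (h ((i + 1 : ℝ) / m) - h ((i : ℝ) / m)) := by simp [d, hi]
    have huv : (i + 1 : ℝ) / m = (i : ℝ) / m + 1 / m := by ring
    have hpos : 0 < 1 / (m : ℝ) := by positivity
    rcases le_or_gt t ((i : ℝ) / m) with h1 | h1
    · rw [min_eq_left h1, min_eq_left (by linarith)]; simp
    rcases le_or_gt ((i + 1 : ℝ) / m) t with h2 | h2
    · rw [min_eq_right h2, min_eq_right h1.le, hd, huv]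
      field_simp; simp
    · rw [min_eq_left h2.le, min_eq_right h1.le, hd]
      have h3 := hc.2 (hmem m i hi.le) (hmem' m i hi)
        (show 0 ≤ ((i + 1 : ℝ) / m - t) * m from mul_nonneg (by linarith) hm.le)
        (show 0 ≤ (t - (i : ℝ) / m) * m from mul_nonneg (by linarith) hm.le)
        (by field_simp; ring)
      have h4 : (((i + 1 : ℝ) / m - t) * m) • ((i : ℝ) / m) +
          ((t - (i : ℝ) / m) * m) • ((i + 1 : ℝ) / m) = t := by
        simp only [smul_eq_mul]; field_simp; ring
      rw [h4] at h3
      simp only [smul_eq_mul] at h3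
      have h5 : ((i + 1 : ℝ) / m - t) * m = 1 - (t - (i : ℝ) / m) * m := by field_simp; ring
      rw [h5] at h3
      linarith
  have hle : ∀ (m : ℕ) {t : ℝ}, t ∈ Set.Icc (0 : ℝ) 1 →
      ∑ i ∈ Finset.range m, (d m i - d m (i + 1)) * min t ((i + 1 : ℝ) / m) ≤ h t := by
    intro m t ht
    rw [habel m ht.1]
    have h1 := Finset.sum_le_sum fun i hi => hupper m ht i (Finset.mem_range.1 hi)
    have h2 := Finset.sum_range_sub (fun i : ℕ => h (min t ((i : ℝ) / m))) m
    push_cast at h2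
    rw [h2] at h1
    refine h1.trans ?_
    have h3 : (0 : ℝ) / m = 0 := by simp
    rw [h3, min_eq_right ht.1, h0, sub_zero]
    exact hmono ⟨le_min ht.1 (by positivity), (min_le_left _ _).trans ht.2⟩ ht (min_le_left _ _)
  -- Dropping the nonnegative terms beyond the last grid point before `t` leaves a telescoping sum.
  have hge : ∀ (m : ℕ) {t : ℝ}, 0 < m → t ∈ Set.Icc (0 : ℝ) 1 → h (⌊t * m⌋₊ / m) ≤
      ∑ i ∈ Finset.range m, (d m i - d m (i + 1)) * min t ((i + 1 : ℝ) / m) := by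
    intro m t hm ht
    have hm' : (0 : ℝ) < m := by exact_mod_cast hm
    rw [habel m ht.1]
    set j := ⌊t * m⌋₊ with hj
    have hjt : (j : ℝ) ≤ t * m := Nat.floor_le (by have := ht.1; positivity)
    have hjm : j ≤ m := by
      have : (j : ℝ) ≤ m := hjt.trans (by nlinarith [ht.2])
      exact_mod_cast this
    have h2 := Finset.sum_range_sub (fun i : ℕ => h ((i : ℝ) / m)) j
    push_cast at h2
    simp only [zero_div, h0, sub_zero] at h2
    rw [← h2]
    calc ∑ i ∈ Finset.range j, (h ((i + 1 : ℝ) / m) - h ((i : ℝ) / m))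
        = ∑ i ∈ Finset.range j, d m i * (min t ((i + 1 : ℝ) / m) - min t ((i : ℝ) / m)) := by
          refine Finset.sum_congr rfl fun i hi => ?_
          have hij := Finset.mem_range.1 hi
          have h3 : (i + 1 : ℝ) / m ≤ t := by
            rw [div_le_iff₀ hm']
            have : ((i + 1 : ℕ) : ℝ) ≤ j := by exact_mod_cast hij
            push_cast at this; linarith
          have h4 : (i : ℝ) / m ≤ t := le_trans (by gcongr; linarith) h3
          have h5 : d m i = m * (h ((i + 1 : ℝ) / m) - h ((i : ℝ) / m)) := by
            simp [d, hij.trans_le hjm]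
          rw [min_eq_right h3, min_eq_right h4, h5]
          field_simp; ring
      _ ≤ _ := by
          refine Finset.sum_le_sum_of_subset_of_nonneg (Finset.range_mono hjm) fun i _ _ => ?_
          refine mul_nonneg (hd0 m i) (sub_nonneg.2 (min_le_min_left _ ?_))
          gcongr; linarith
  refine ⟨fun m i => d m i - d m (i + 1), hdanti, fun t ht => ⟨fun m => hle m ht, ?_⟩⟩
  rcases ht.1.eq_or_lt with rfl | htpos
  · refine Tendsto.congr (fun m => ?_) (by rw [h0]; exact tendsto_const_nhds)
    refine (Finset.sum_eq_zero fun i _ => ?_).symm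
    rw [min_eq_left (by positivity), mul_zero]
  -- No continuity of `h` is needed: concavity and `h 0 = 0` give `h s ≥ (s / t) * h t` for the grid
  -- point `s` below `t`.
  · have hlow : Tendsto (fun m : ℕ => (⌊t * m⌋₊ / m : ℝ) / t * h t) atTop (𝓝 (h t)) := by
      have h1 := ((tendsto_nat_floor_mul_div_atTop htpos.le).comp
        tendsto_natCast_atTop_atTop).div_const t |>.mul_const (h t)
      rw [div_self htpos.ne', one_mul] at h1
      exact h1
    refine tendsto_of_tendsto_of_tendsto_of_le_of_le' hlow tendsto_const_nhds ?_
      (Eventually.of_forall fun m => hle m ht)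
    filter_upwards [eventually_gt_atTop 0] with m hm
    refine le_trans ?_ (hge m hm ht)
    have hm' : (0 : ℝ) < m := by exact_mod_cast hm
    have hs : (⌊t * m⌋₊ / m : ℝ) ≤ t := by
      rw [div_le_iff₀ hm']; exact Nat.floor_le (by positivity)
    have hs' : (⌊t * m⌋₊ / m : ℝ) / t ≤ 1 := (div_le_one htpos).2 hs
    have h1 := hc.2 (Set.left_mem_Icc.2 zero_le_one) ht (sub_nonneg.2 hs')
      (show 0 ≤ (⌊t * m⌋₊ / m : ℝ) / t by positivity) (by ring)
    simp only [smul_eq_mul, h0, mul_zero, zero_add] at h1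
    rwa [div_mul_cancel₀ _ htpos.ne'] at h1

end ConcaveApproximation

/-! ### Concave distortions yield convexity and monotonicity in increasing convex order. -/

section Distortion

variable {Ω : Type*} [MeasurableSpace Ω] {P : Measure Ω} [IsProbabilityMeasure P]

theorem measurableSet_lt_of_loss (X : Loss Ω) (t : ℝ) : MeasurableSet {ω | t < X ω} :=
  measurableSet_lt measurable_const X.2.1

theorem choquetIntegral_loss {ν : Set Ω → ℝ} (h0 : ν ∅ = 0) (h1 : ν Set.univ = 1) (X : Loss Ω) :
    choquetIntegral ν X = ∫ t in Set.Ioc (0 : ℝ) 1, ν {ω | t < X ω} := by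
  have hneg : ∫ t in Set.Iio (0 : ℝ), (ν {ω | t < X ω} - 1) = 0 := by
    refine setIntegral_eq_zero_of_forall_eq_zero fun t ht => ?_
    have : {ω | t < X ω} = Set.univ := Set.eq_univ_of_forall fun ω =>
      lt_of_lt_of_le (Set.mem_Iio.1 ht) (X.2.2 ω).1
    rw [this, h1, sub_self]
  rw [choquetIntegral, hneg, add_zero]
  refine setIntegral_eq_of_subset_of_forall_sdiff_eq_zero measurableSet_Ioi
    (fun t ht => ht.1) fun t ht => ?_
  have ht1 : 1 < t := by
    by_contra! h; exact ht.2 ⟨ht.1, h⟩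
  have : {ω | t < X ω} = ∅ := Set.eq_empty_of_forall_notMem fun ω (hω : t < X ω) => by
    linarith [(X.2.2 ω).2]
  rw [this, h0]

theorem antitone_survival (X : Ω → ℝ) : Antitone fun t : ℝ => P.real {ω | t < X ω} :=
  fun _ _ hst => measureReal_mono fun _ (hω : _ < _) => hst.trans_lt hω

theorem integrableOn_of_antitone_of_mem_Icc {f : ℝ → ℝ} (hf : Antitone f)
    (h01 : ∀ t, f t ∈ Set.Icc (0 : ℝ) 1) : IntegrableOn f (Set.Ioc 0 1) :=
  Integrable.of_bound hf.measurable.aestronglyMeasurable 1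
    (Eventually.of_forall fun t => by
      rw [Real.norm_eq_abs, abs_of_nonneg (h01 t).1]; exact (h01 t).2)

theorem integral_loss_eq (X : Loss Ω) :
    ∫ ω, X ω ∂P = ∫ t in Set.Ioc (0 : ℝ) 1, P.real {ω | t < X ω} := by
  rw [← choquetIntegral_loss (ν := P.real) (by simp) (by simp), choquetIntegral]
  have hneg : ∫ t in Set.Iio (0 : ℝ), (P.real {ω | t < X ω} - 1) = 0 := by
    refine setIntegral_eq_zero_of_forall_eq_zero fun t ht => ?_
    have : {ω | t < X ω} = Set.univ := Set.eq_univ_of_forall fun ω =>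
      lt_of_lt_of_le (Set.mem_Iio.1 ht) (X.2.2 ω).1
    rw [this]; simp
  rw [hneg, add_zero]
  exact Integrable.integral_eq_integral_meas_lt
    (integrable_of_continuous_of_mem_Icc continuous_id X.2.1 X.2.2)
    (Eventually.of_forall fun ω => (X.2.2 ω).1)

/-- The loss `max X x`. -/
def Loss.sup (X : Loss Ω) (x : Set.Icc (0 : ℝ) 1) : Loss Ω :=
  ⟨fun ω => max (X ω) x, X.2.1.max measurable_const, fun ω =>
    ⟨(X.2.2 ω).1.trans (le_max_left _ _), max_le (X.2.2 ω).2 x.2.2⟩⟩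

theorem setIntegral_Ioc_ite {α : ℝ} (x : Set.Icc (0 : ℝ) 1) :
    IntegrableOn (fun t : ℝ => if t < (x : ℝ) then α else 0) (Set.Ioc 0 1) ∧
    ∫ t in Set.Ioc (0 : ℝ) 1, (if t < (x : ℝ) then α else 0) = α * x := by
  have e : (fun t : ℝ => if t < (x : ℝ) then α else 0) = (Set.Iio (x : ℝ)).indicator fun _ => α := by
    ext t; simp [Set.indicator_apply]
  have e2 : Set.Ioc (0 : ℝ) 1 ∩ Set.Iio (x : ℝ) = Set.Ioo 0 (x : ℝ) := by
    ext t
    simp only [Set.mem_inter_iff, Set.mem_Ioc, Set.mem_Iio, Set.mem_Ioo]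
    exact ⟨fun h => ⟨h.1.1, h.2⟩, fun h => ⟨⟨h.1, h.2.le.trans x.2.2⟩, h.2⟩⟩
  rw [e]
  refine ⟨(integrable_const α).indicator measurableSet_Iio, ?_⟩
  rw [setIntegral_indicator measurableSet_Iio, e2]
  simp [x.2.1, mul_comm]

theorem survival_sup (X : Loss Ω) (x : Set.Icc (0 : ℝ) 1) (t : ℝ) :
    P.real {ω | t < X.sup x ω} = if t < (x : ℝ) then 1 else P.real {ω | t < X ω} := by
  split_ifs with h
  · have : {ω | t < X.sup x ω} = Set.univ :=
      Set.eq_univ_of_forall fun ω => lt_of_lt_of_le h (le_max_right _ _)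
    rw [this]; simp
  · congr 1
    ext ω
    simp [Loss.sup, h]

theorem survival_mem_Icc (X : Ω → ℝ) (t : ℝ) : P.real {ω | t < X ω} ∈ Set.Icc (0 : ℝ) 1 :=
  ⟨measureReal_nonneg, measureReal_le_one⟩

theorem integrableOn_min_survival (X : Ω → ℝ) (α : Set.Icc (0 : ℝ) 1) :
    IntegrableOn (fun t => min (P.real {ω | t < X ω}) α) (Set.Ioc 0 1) :=
  integrableOn_of_antitone_of_mem_Icc (fun _ _ hst => min_le_min_right _ (antitone_survival X hst))
    fun t => ⟨le_min (survival_mem_Icc X t).1 α.2.1, (min_le_left _ _).trans (survival_mem_Icc X t).2⟩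

theorem integral_sup_eq (X : Loss Ω) (α x : Set.Icc (0 : ℝ) 1) :
    (α - 1) * x + ∫ ω, X.sup x ω ∂P = ∫ t in Set.Ioc (0 : ℝ) 1,
      ((if t < (x : ℝ) then (α : ℝ) - 1 else 0) + P.real {ω | t < X.sup x ω}) := by
  rw [integral_add (setIntegral_Ioc_ite x).1
    (integrableOn_of_antitone_of_mem_Icc (antitone_survival _) (survival_mem_Icc _)),
    (setIntegral_Ioc_ite x).2, integral_loss_eq]

/-- In layer form the right-hand integrand is `α` below `x` and the survival function from `x` on;
either dominates the minimum of the two. -/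
theorem integral_min_survival_le (X : Loss Ω) (α x : Set.Icc (0 : ℝ) 1) :
    ∫ t in Set.Ioc (0 : ℝ) 1, min (P.real {ω | t < X ω}) α ≤
      (α - 1) * x + ∫ ω, X.sup x ω ∂P := by
  rw [integral_sup_eq]
  refine integral_mono (integrableOn_min_survival X α) ((setIntegral_Ioc_ite x).1.add
    (integrableOn_of_antitone_of_mem_Icc (antitone_survival _) (survival_mem_Icc _))) fun t => ?_
  simp only [survival_sup]
  split_ifs with h
  · linarith [min_le_right (P.real {ω | t < X ω}) (α : ℝ)]
  · linarith [min_le_left (P.real {ω | t < X ω}) (α : ℝ)]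

/-- The preceding bound is sharp at the point where the survival function of `X` crosses the level
`α`. -/
theorem exists_integral_min_survival_eq (X : Loss Ω) (α : Set.Icc (0 : ℝ) 1) :
    ∃ x : Set.Icc (0 : ℝ) 1, ∫ t in Set.Ioc (0 : ℝ) 1, min (P.real {ω | t < X ω}) α =
      (α - 1) * x + ∫ ω, X.sup x ω ∂P := by
  -- Inserting 0 keeps the set nonempty when the survival function lies below `α` throughout.
  set T : Set ℝ := insert 0 {t ∈ Set.Icc (0 : ℝ) 1 | (α : ℝ) ≤ P.real {ω | t < X ω}} with hT
  have hT01 : ∀ t ∈ T, t ∈ Set.Icc (0 : ℝ) 1 := by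
    rintro t (rfl | ht)
    · exact Set.left_mem_Icc.2 zero_le_one
    · exact ht.1
  have hbdd : BddAbove T := ⟨1, fun t ht => (hT01 t ht).2⟩
  have h0T : (0 : ℝ) ∈ T := Set.mem_insert _ _
  let x : Set.Icc (0 : ℝ) 1 := ⟨sSup T, le_csSup hbdd h0T, csSup_le ⟨0, h0T⟩ fun t ht => (hT01 t ht).2⟩
  refine ⟨x, ?_⟩
  rw [integral_sup_eq]
  refine setIntegral_congr_ae measurableSet_Ioc ?_
  have hne : ∀ᵐ t : ℝ, t ≠ x := by simp [ae_iff]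
  filter_upwards [hne] with t htx ht
  rw [survival_sup]
  split_ifs with h
  · obtain ⟨s, hs, hts⟩ := exists_lt_of_lt_csSup ⟨0, h0T⟩ h
    rcases hs with rfl | hs
    · exact absurd ht.1 hts.not_gt
    · rw [min_eq_right (hs.2.trans (antitone_survival _ hts.le))]; ring
  · have hlt : (x : ℝ) < t := lt_of_le_of_ne (not_lt.1 h) htx.symm
    have : ¬ (α : ℝ) ≤ P.real {ω | t < X ω} := fun hα =>
      (le_csSup hbdd (Or.inr ⟨⟨ht.1.le, ht.2⟩, hα⟩)).not_gt hlt
    rw [min_eq_left (not_le.1 this).le, zero_add]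

/-- The inequality is linear in the distortion, so it passes to nonnegative combinations of the
functions `min · α` and, by dominated convergence, to their limits. General `a`, `b` cover both
convexity and order monotonicity. -/
theorem distorted_integral_le_of_min {h : ℝ → ℝ} (hmono : MonotoneOn h (Set.Icc 0 1))
    (h0 : h 0 = 0) (h1 : h 1 = 1) (hc : ConcaveOn ℝ (Set.Icc 0 1) h) (X Y W : Loss Ω) {a b : ℝ}
    (hmin : ∀ α : Set.Icc (0 : ℝ) 1,
      ∫ t in Set.Ioc (0 : ℝ) 1, min (P.real {ω | t < W ω}) α ≤
        a * (∫ t in Set.Ioc (0 : ℝ) 1, min (P.real {ω | t < X ω}) α) +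
        b * ∫ t in Set.Ioc (0 : ℝ) 1, min (P.real {ω | t < Y ω}) α) :
    ∫ t in Set.Ioc (0 : ℝ) 1, h (P.real {ω | t < W ω}) ≤
      a * (∫ t in Set.Ioc (0 : ℝ) 1, h (P.real {ω | t < X ω})) +
      b * ∫ t in Set.Ioc (0 : ℝ) 1, h (P.real {ω | t < Y ω}) := by
  obtain ⟨c, hc0, hct⟩ := exists_min_combination_tendsto hmono h0 hc
  let R : ℕ → Loss Ω → ℝ := fun m X => ∫ t in Set.Ioc (0 : ℝ) 1,
    ∑ i ∈ Finset.range m, c m i * min (P.real {ω | t < X ω}) ((i + 1 : ℝ) / m)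
  have hα : ∀ m i, i ∈ Finset.range m → (i + 1 : ℝ) / m ∈ Set.Icc (0 : ℝ) 1 := fun m i hi =>
    ⟨by positivity, div_le_one_of_le₀ (by exact_mod_cast Finset.mem_range.1 hi) (Nat.cast_nonneg m)⟩
  have hR : ∀ m X, R m X = ∑ i ∈ Finset.range m, c m i *
      ∫ t in Set.Ioc (0 : ℝ) 1, min (P.real {ω | t < X ω}) ((i + 1 : ℝ) / m) := by
    intro m X
    simp only [R]
    rw [integral_finsetSum _ fun i hi =>
      (integrableOn_min_survival X.1 ⟨_, hα m i hi⟩).const_mul (c m i)]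
    exact Finset.sum_congr rfl fun i _ => integral_const_mul _ _
  have hle : ∀ m, R m W ≤ a * R m X + b * R m Y := by
    intro m
    rw [hR, hR, hR, Finset.mul_sum, Finset.mul_sum, ← Finset.sum_add_distrib]
    refine Finset.sum_le_sum fun i hi => ?_
    calc _ ≤ _ := mul_le_mul_of_nonneg_left (hmin ⟨_, hα m i hi⟩)
          (hc0 m i (Finset.mem_range.1 hi))
      _ = _ := by ring
  have hlim : ∀ X : Loss Ω, Tendsto (fun m => R m X) atTop
      (𝓝 (∫ t in Set.Ioc (0 : ℝ) 1, h (P.real {ω | t < X ω}))) := by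
    intro X
    refine tendsto_integral_of_dominated_convergence (fun _ => 1) (fun m => ?_)
      (integrable_const 1) (fun m => Eventually.of_forall fun t => ?_)
      (Eventually.of_forall fun t => (hct _ (survival_mem_Icc X.1 t)).2)
    · exact (Finset.measurable_fun_sum _ fun i _ => (((antitone_survival X.1).measurable).min
        measurable_const).const_mul _).aestronglyMeasurable
    · have hS := survival_mem_Icc (P := P) X.1 t
      rw [Real.norm_eq_abs, abs_of_nonneg]
      · exact ((hct _ hS).1 m).trans
          ((hmono hS (Set.right_mem_Icc.2 zero_le_one) hS.2).trans_eq h1)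
      · exact Finset.sum_nonneg fun i hi => mul_nonneg (hc0 m i (Finset.mem_range.1 hi))
          (le_min hS.1 (by positivity))
  exact le_of_tendsto_of_tendsto' (hlim W) (((hlim X).const_mul a).add ((hlim Y).const_mul b)) hle

theorem IsDistortionFunction.eq_setIntegral {h : ℝ → ℝ} {ρ : BoundedRV Ω → ℝ}
    (hh : IsDistortionFunction P h ρ) (X : Loss Ω) :
    ρ X.toBounded = ∫ t in Set.Ioc (0 : ℝ) 1, h (P.real {ω | t < X ω}) := by
  rw [hh.eq_integral]
  exact choquetIntegral_loss (ν := fun A => h (P.real A)) (by simp [hh.zero]) (by simp [hh.one]) X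

theorem IsDistortionFunction.mix_le {h : ℝ → ℝ} {ρ : BoundedRV Ω → ℝ}
    (hh : IsDistortionFunction P h ρ) (hc : ConcaveOn ℝ (Set.Icc 0 1) h) (s : Set.Icc (0 : ℝ) 1)
    (X Y : Loss Ω) :
    ρ (Loss.mix s X Y).toBounded ≤ s * ρ X.toBounded + (1 - s) * ρ Y.toBounded := by
  rw [hh.eq_setIntegral, hh.eq_setIntegral, hh.eq_setIntegral]
  refine distorted_integral_le_of_min (P := P) hh.mono hh.zero hh.one hc X Y _ fun α => ?_
  obtain ⟨x, hx⟩ := exists_integral_min_survival_eq (P := P) X α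
  obtain ⟨y, hy⟩ := exists_integral_min_survival_eq (P := P) Y α
  have hs0 : (0 : ℝ) ≤ s := s.2.1
  have hs1 : (0 : ℝ) ≤ 1 - s := sub_nonneg.2 s.2.2
  -- Mixing the optimal levels works because `(X, x) ↦ max X x` is jointly convex.
  let z : Set.Icc (0 : ℝ) 1 := ⟨s * x + (1 - s) * y,
    (convex_Icc (0 : ℝ) 1) x.2 y.2 hs0 hs1 (by ring)⟩
  have hint : ∀ X : Loss Ω, Integrable (fun ω => X ω) P := fun X =>
    integrable_of_continuous_of_mem_Icc continuous_id X.2.1 X.2.2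
  have hsup : ∫ ω, (Loss.mix s X Y).sup z ω ∂P ≤
      s * (∫ ω, X.sup x ω ∂P) + (1 - s) * ∫ ω, Y.sup y ω ∂P := by
    rw [← integral_const_mul, ← integral_const_mul,
      ← integral_add ((hint _).const_mul _) ((hint _).const_mul _)]
    refine integral_mono (hint _) (((hint _).const_mul _).add ((hint _).const_mul _)) fun ω => ?_
    refine max_le ?_ ?_
    · exact add_le_add (mul_le_mul_of_nonneg_left (le_max_left _ _) hs0)
        (mul_le_mul_of_nonneg_left (le_max_left _ _) hs1)
    · exact add_le_add (mul_le_mul_of_nonneg_left (le_max_right _ _) hs0)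
        (mul_le_mul_of_nonneg_left (le_max_right _ _) hs1)
  refine (integral_min_survival_le _ α z).trans ?_
  rw [hx, hy]
  have hz : (z : ℝ) = s * x + (1 - s) * y := rfl
  rw [hz]
  linarith

theorem IsDistortionFunction.le_of_icxLE {h : ℝ → ℝ} {ρ : BoundedRV Ω → ℝ}
    (hh : IsDistortionFunction P h ρ) (hc : ConcaveOn ℝ (Set.Icc 0 1) h)
    {X Y : Loss Ω} (hXY : IcxLE P X.toBounded Y.toBounded) :
    ρ X.toBounded ≤ ρ Y.toBounded := by
  rw [hh.eq_setIntegral, hh.eq_setIntegral]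
  have key := distorted_integral_le_of_min (P := P) hh.mono hh.zero hh.one hc Y Y X
    (a := 1) (b := 0) fun α => ?_
  · simpa using key
  obtain ⟨y, hy⟩ := exists_integral_min_survival_eq (P := P) Y α
  rw [one_mul, zero_mul, hy]
  refine le_add_of_le_of_nonneg ?_ le_rfl
  refine (integral_min_survival_le _ α y).trans (add_le_add_right ?_ _)
  -- The level optimal for `Y` is merely admissible for `X`, and `max · y` is an increasing convex
  -- test function.
  exact hXY (fun t => max t y) (fun _ _ hst => max_le_max_right _ hst)
    ((convexOn_id convex_univ).sup (convexOn_const _ convex_univ))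

end Distortion

/-! ### Concavity from midpoint inequalities at small scales. -/

section LocalMidpoint

/-- An increasing left-continuous function that is midpoint concave at arbitrarily small scales
around every interior point is concave. -/
theorem concaveOn_of_local_midpoint {h : ℝ → ℝ} (hmono : MonotoneOn h (Set.Icc 0 1))
    (hleft : ∀ t ∈ Set.Ioc (0 : ℝ) 1, ∀ y < h t, ∃ s ∈ Set.Ico 0 t, y < h s)
    (hmid : ∀ r ∈ Set.Ioo (0 : ℝ) 1, ∀ ε > 0, ∃ η ∈ Set.Ioo 0 ε, h (r - η) + h (r + η) ≤ 2 * h r) :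
    ConcaveOn ℝ (Set.Icc 0 1) h := by
  have hlsc : LowerSemicontinuousOn h (Set.Icc 0 1) := by
    intro t ht y hy
    rcases ht.1.eq_or_lt with rfl | htpos
    · exact eventually_nhdsWithin_of_forall fun z hz =>
        lt_of_lt_of_le hy (hmono (Set.left_mem_Icc.2 zero_le_one) hz hz.1)
    · obtain ⟨s, hs, hys⟩ := hleft t ⟨htpos, ht.2⟩ y hy
      refine eventually_nhdsWithin_iff.2 ?_
      filter_upwards [eventually_gt_nhds hs.2] with z hz hz01
      exact lt_of_lt_of_le hys (hmono ⟨hs.1, hs.2.le.trans ht.2⟩ hz01 hz.le)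
  refine LinearOrder.concaveOn_of_lt (convex_Icc 0 1) fun x hx y hy hxy a b ha hb hab => ?_
  simp only [smul_eq_mul]
  set σ : ℝ := (h y - h x) / (y - x) with hσ
  have hσ' : σ * (y - x) = h y - h x := div_mul_cancel₀ _ (sub_pos.2 hxy).ne'
  -- `h` minus its chord. Being lower semicontinuous, it attains its minimum, and the claim is that
  -- this minimum is nonnegative.
  let g : ℝ → ℝ := fun z => h z + -(h x + σ * (z - x))
  have hgx : g x = 0 := by simp [g]
  have hgy : g y = 0 := by simp only [g, hσ']; ring
  have hsub : Set.Icc x y ⊆ Set.Icc 0 1 := Set.Icc_subset_Icc hx.1 hy.2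
  have hg : LowerSemicontinuousOn g (Set.Icc x y) :=
    (hlsc.mono hsub).add (by fun_prop : Continuous fun z : ℝ =>
      -(h x + σ * (z - x))).continuousOn.lowerSemicontinuousOn
  obtain ⟨r₀, hr₀, hmin⟩ := hg.exists_isMinOn (Set.nonempty_Icc.2 hxy.le) isCompact_Icc
  have hmin' : ∀ z ∈ Set.Icc x y, g r₀ ≤ g z := fun z hz => hmin hz
  suffices hm : 0 ≤ g r₀ by
    have hz : a * x + b * y ∈ Set.Icc x y := by
      have : a = 1 - b := by linarith
      subst this
      constructor <;> nlinarith
    have h1 := hm.trans (hmin' _ hz)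
    simp only [g] at h1
    have h2 : σ * (a * x + b * y - x) = b * (σ * (y - x)) := by
      have : a = 1 - b := by linarith
      rw [this]; ring
    rw [h2, hσ'] at h1
    have h3 : a = 1 - b := by linarith
    rw [h3]
    rw [h3] at h1
    linarith
  by_contra! hneg
  set M : Set ℝ := {z ∈ Set.Icc x y | g z ≤ g r₀} with hM
  have hMne : M.Nonempty := ⟨r₀, hr₀, le_rfl⟩
  have hMbdd : BddBelow M := ⟨x, fun z hz => hz.1.1⟩
  -- The leftmost minimizer, attained by lower semicontinuity. Just to its left `g` is strictly
  -- above the minimum and to its right at least equal to it, which contradicts the midpoint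
  -- inequality at `r`.
  set r := sInf M with hr
  have hrI : r ∈ Set.Icc x y :=
    ⟨le_csInf hMne fun z hz => hz.1.1, (csInf_le hMbdd ⟨hr₀, le_rfl⟩).trans hr₀.2⟩
  have hrM : g r ≤ g r₀ := by
    by_contra! hlt
    have h1 := eventually_nhdsWithin_iff.1 (hg r hrI _ hlt)
    have h2 := mem_closure_iff_frequently.1 (csInf_mem_closure hMne hMbdd)
    obtain ⟨z, hz, hz'⟩ := (h2.and_eventually h1).exists
    exact (hz' hz.1).not_ge hz.2
  have hxr : x < r := lt_of_le_of_ne hrI.1 fun e => by rw [← e, hgx] at hrM; linarith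
  have hry : r < y := lt_of_le_of_ne hrI.2 fun e => by rw [e, hgy] at hrM; linarith
  obtain ⟨η, hη, hη2⟩ := hmid r ⟨hx.1.trans_lt hxr, hry.trans_le hy.2⟩ (min (r - x) (y - r))
    (lt_min (sub_pos.2 hxr) (sub_pos.2 hry))
  have h1 : η < r - x := hη.2.trans_le (min_le_left _ _)
  have h2 : η < y - r := hη.2.trans_le (min_le_right _ _)
  have hη0 : 0 < η := hη.1
  have h3 : g r₀ < g (r - η) := by
    by_contra! hle
    have := csInf_le hMbdd (⟨⟨by linarith, by linarith⟩, hle⟩ : r - η ∈ M)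
    linarith
  have h4 : g r₀ ≤ g (r + η) := hmin' _ ⟨by linarith, by linarith⟩
  have h5 : g (r - η) + g (r + η) ≤ 2 * g r := by
    simp only [g]; linarith
  linarith

end LocalMidpoint

/-! ### Reading the capacity off a single rating boundary. -/

section Threshold

variable {Ω : Type*} [MeasurableSpace Ω] {P : Measure Ω}

/-- The Choquet integral of a loss with at most three values. -/
theorem choquetIntegral_two_step {ν : Set Ω → ℝ} (h0 : ν ∅ = 0) (h1 : ν Set.univ = 1)
    {A D : Set Ω} (hAD : A ⊆ D) {b a₁ a₂ : ℝ} (hb : 0 ≤ b) (ha₁ : 0 ≤ a₁) (ha₂ : 0 ≤ a₂)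
    (hle : b + a₁ + a₂ ≤ 1) (X : Loss Ω)
    (hX : ∀ ω, X ω = b + a₁ * A.indicator 1 ω + a₂ * D.indicator 1 ω) :
    choquetIntegral ν X = b + a₁ * ν A + a₂ * ν D := by
  rw [choquetIntegral_loss h0 h1]
  let x : Set.Icc (0 : ℝ) 1 := ⟨b, hb, by linarith⟩
  let y : Set.Icc (0 : ℝ) 1 := ⟨b + a₂, by linarith, by linarith⟩
  let z : Set.Icc (0 : ℝ) 1 := ⟨b + a₁ + a₂, by linarith, hle⟩
  -- The loss equals `x` off `D`, `y` on `D \ A` and `z` on `A`, so the super-level sets are `Ω`,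
  -- `D`, `A`, `∅` in turn.
  have hpt : ∀ t : ℝ, ν {ω | t < X ω} = ((if t < (x : ℝ) then 1 - ν D else 0) +
      (if t < (y : ℝ) then ν D - ν A else 0)) + (if t < (z : ℝ) then ν A else 0) := by
    intro t
    have hcases : ∀ ω, (ω ∈ A ∧ X ω = z) ∨ (ω ∉ A ∧ ω ∈ D ∧ X ω = y) ∨ (ω ∉ D ∧ X ω = x) := by
      intro ω
      by_cases hA : ω ∈ A
      · exact Or.inl ⟨hA, by simp [hX, hA, hAD hA, z]⟩
      · by_cases hD : ω ∈ D
        · exact Or.inr (Or.inl ⟨hA, hD, by simp [hX, hA, hD, y]⟩)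
        · exact Or.inr (Or.inr ⟨hD, by simp [hX, hA, hD, x]⟩)
    have hxy : (x : ℝ) ≤ y := by simp only [x, y]; linarith
    have hyz : (y : ℝ) ≤ z := by simp only [z, y]; linarith
    by_cases h3 : t < (x : ℝ)
    · have : {ω | t < X ω} = Set.univ := Set.eq_univ_of_forall fun ω => by
        change t < X ω
        rcases hcases ω with h | h | h
        · rw [h.2]; linarith
        · rw [h.2.2]; linarith
        · rw [h.2]; exact h3
      rw [this, if_pos h3, if_pos (h3.trans_le hxy), if_pos (h3.trans_le (hxy.trans hyz)), h1]
      ring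
    by_cases h4 : t < (y : ℝ)
    · have : {ω | t < X ω} = D := by
        ext ω
        change t < X ω ↔ _
        rcases hcases ω with h | h | h
        · simp only [h.2, hAD h.1, iff_true]; linarith
        · simp only [h.2.2, h.2.1, iff_true]; linarith
        · simp only [h.2, h.1, iff_false]; linarith
      rw [this, if_neg h3, if_pos h4, if_pos (h4.trans_le hyz)]
      ring
    by_cases h5 : t < (z : ℝ)
    · have : {ω | t < X ω} = A := by
        ext ω
        change t < X ω ↔ _
        rcases hcases ω with h | h | h
        · simp only [h.2, h.1, iff_true]; linarith
        · simp only [h.2.2, h.1, iff_false]; linarith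
        · have hA : ω ∉ A := fun hA => h.1 (hAD hA)
          simp only [h.2, hA, iff_false]; linarith
      rw [this, if_neg h3, if_neg h4, if_pos h5]
      ring
    · have : {ω | t < X ω} = ∅ := Set.eq_empty_of_forall_notMem fun ω (hω : t < X ω) => by
        rcases hcases ω with h | h | h
        · rw [h.2] at hω; linarith
        · rw [h.2.2] at hω; linarith
        · rw [h.2] at hω; linarith
      rw [this, if_neg h3, if_neg h4, if_neg h5, h0]
      ring
  simp_rw [hpt]
  rw [integral_add (f := fun t : ℝ => (if t < (x : ℝ) then 1 - ν D else 0) +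
      if t < (y : ℝ) then ν D - ν A else 0) ((setIntegral_Ioc_ite x).1.add (setIntegral_Ioc_ite y).1)
    (setIntegral_Ioc_ite z).1, integral_add (setIntegral_Ioc_ite x).1 (setIntegral_Ioc_ite y).1,
    (setIntegral_Ioc_ite x).2, (setIntegral_Ioc_ite y).2, (setIntegral_Ioc_ite z).2]
  simp only [x, y, z]
  ring

/-- The loss `b + a 1_A`. -/
noncomputable def Loss.step {b a : ℝ} (hb : 0 ≤ b) (ha : 0 ≤ a) (hba : b + a ≤ 1) {A : Set Ω}
    (hA : MeasurableSet A) : Loss Ω :=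
  ⟨fun ω => b + a * A.indicator 1 ω, ((measurable_one.indicator hA).const_mul a).const_add b,
    fun ω => by
      by_cases h : ω ∈ A
      · simp only [h, Set.indicator_of_mem, Pi.one_apply, mul_one]
        exact ⟨add_nonneg hb ha, hba⟩
      · simp only [h, not_false_eq_true, Set.indicator_of_notMem, mul_zero, add_zero]
        exact ⟨hb, by linarith⟩⟩

theorem choquetIntegral_step {ν : Set Ω → ℝ} (h0 : ν ∅ = 0) (h1 : ν Set.univ = 1)
    {b a : ℝ} (hb : 0 ≤ b) (ha : 0 ≤ a) (hba : b + a ≤ 1) {A : Set Ω} (hA : MeasurableSet A) :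
    choquetIntegral ν (Loss.step hb ha hba hA) = b + a * ν A := by
  rw [choquetIntegral_two_step h0 h1 (subset_refl A) hb ha le_rfl (by linarith)
    (Loss.step hb ha hba hA) fun ω => by simp [Loss.step]]
  ring

theorem IsCapacity.mem_Icc {ν : Set Ω → ℝ} (hν : IsCapacity ν) {A : Set Ω}
    (hA : MeasurableSet A) : ν A ∈ Set.Icc (0 : ℝ) 1 :=
  ⟨hν.empty.symm.trans_le (hν.mono _ _ MeasurableSet.empty hA (Set.empty_subset _)),
    (hν.mono _ _ hA MeasurableSet.univ (Set.subset_univ _)).trans_eq hν.univ⟩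

theorem IsCapacity.choquetIntegral_mem_Icc {ν : Set Ω → ℝ} (hν : IsCapacity ν) (X : Loss Ω) :
    choquetIntegral ν X ∈ Set.Icc (0 : ℝ) 1 := by
  have hS : ∀ t : ℝ, ν {ω | t < X ω} ∈ Set.Icc (0 : ℝ) 1 := fun t =>
    hν.mem_Icc (measurableSet_lt_of_loss X t)
  have hanti : Antitone fun t : ℝ => ν {ω | t < X ω} := fun s t hst =>
    hν.mono _ _ (measurableSet_lt_of_loss X t) (measurableSet_lt_of_loss X s)
      fun ω (hω : t < X ω) => hst.trans_lt hω
  rw [choquetIntegral_loss hν.empty hν.univ]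
  refine ⟨integral_nonneg fun t => (hS t).1, ?_⟩
  calc ∫ t in Set.Ioc (0 : ℝ) 1, ν {ω | t < X ω} ≤ ∫ _t in Set.Ioc (0 : ℝ) 1, (1 : ℝ) :=
        integral_mono (integrableOn_of_antitone_of_mem_Icc hanti hS) (integrable_const 1)
          fun t => (hS t).2
    _ = 1 := by simp

/-- The rating is at most `k` exactly when the Choquet integral is at most a level in `(0,1)`. -/
theorem exists_threshold {n : ℕ} {I : Loss Ω → ℕ} {ρ : BoundedRV Ω → ℝ}
    (hI : IsChoquetRatingCriterion n I ρ) (hLS : LowerSemicontinuousAS P I) {ν : Set Ω → ℝ}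
    (hν : IsCapacity ν) (hρ : ∀ X : BoundedRV Ω, ρ X = choquetIntegral ν X) :
    ∃ c ∈ Set.Ioo (0 : ℝ) 1, ∃ k, ∀ X : Loss Ω, I X ≤ k ↔ choquetIntegral ν X ≤ c := by
  obtain ⟨-, -, f, hf, hne, hIf⟩ := hI
  obtain ⟨x, hx, y, hy, hxy, hfxy⟩ : ∃ x ∈ Set.Ioo (0 : ℝ) 1, ∃ y ∈ Set.Ioo (0 : ℝ) 1,
      x ≤ y ∧ f x < f y := by
    obtain ⟨x, hx, y, hy, hne⟩ := hne
    have h1 := Set.Ioo_subset_Icc_self hx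
    have h2 := Set.Ioo_subset_Icc_self hy
    rcases le_total x y with h | h
    · exact ⟨x, hx, y, hy, h, lt_of_le_of_ne (hf.mono h1 h2 h) hne⟩
    · exact ⟨y, hy, x, hx, h, lt_of_le_of_ne (hf.mono h2 h1 h) hne.symm⟩
  set T : Set ℝ := {z ∈ Set.Icc (0 : ℝ) 1 | f z ≤ f x} with hT
  have hxT : x ∈ T := ⟨Set.Ioo_subset_Icc_self hx, le_rfl⟩
  have hTy : ∀ z ∈ T, z ≤ y := fun z hz => by
    by_contra! h
    exact absurd (hf.mono (Set.Ioo_subset_Icc_self hy) hz.1 h.le) (by have := hz.2; omega)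
  have hbdd : BddAbove T := ⟨y, hTy⟩
  set c := sSup T with hc
  have hc01 : c ∈ Set.Ioo (0 : ℝ) 1 :=
    ⟨hx.1.trans_le (le_csSup hbdd hxT), (csSup_le ⟨x, hxT⟩ hTy).trans_lt hy.2⟩
  have hlt : ∀ z ∈ Set.Icc (0 : ℝ) 1, z < c → f z ≤ f x := fun z hz hzc => by
    obtain ⟨w, hw, hzw⟩ := exists_lt_of_lt_csSup ⟨x, hxT⟩ hzc
    exact (hf.mono hz hw.1 hzw.le).trans hw.2
  have hIν : ∀ X : Loss Ω, I X = f (choquetIntegral ν X) := fun X => by rw [hIf, hρ]; rfl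
  have hcap := hν.choquetIntegral_mem_Icc
  let const : ∀ z ∈ Set.Icc (0 : ℝ) 1, Loss Ω := fun z hz =>
    Loss.step hz.1 le_rfl (by simpa using hz.2) MeasurableSet.empty
  have hconst : ∀ z hz, I (const z hz) = f z := fun z hz => by
    rw [hIν, choquetIntegral_step hν.empty hν.univ, zero_mul, add_zero]
  -- [LS] along constant losses increasing to `c` shows that the supremum `c` itself belongs to `T`.
  have hfc : f c ≤ f x := by
    have hu : ∀ m : ℕ, c * (1 - 1 / ((m : ℝ) + 1)) ∈ Set.Icc (0 : ℝ) 1 := fun m => by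
      have h1 : 1 / ((m : ℝ) + 1) ≤ 1 := div_le_one_of_le₀ (by linarith [m.cast_nonneg (α := ℝ)])
        (by positivity)
      have h2 : 0 ≤ 1 / ((m : ℝ) + 1) := by positivity
      exact ⟨mul_nonneg hc01.1.le (by linarith), by nlinarith [hc01.1, hc01.2]⟩
    have h := hLS (fun m => const _ (hu m)) (const c (Set.Ioo_subset_Icc_self hc01))
      (Eventually.of_forall fun ω => by
        simp only [const, Loss.step, zero_mul, add_zero]
        have : Tendsto (fun m : ℕ => c * (1 - 1 / ((m : ℝ) + 1))) atTop (𝓝 (c * (1 - 0))) :=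
          (tendsto_const_nhds.sub tendsto_one_div_add_atTop_nhds_zero_nat).const_mul c
        simpa using this)
    rw [hconst _ (Set.Ioo_subset_Icc_self hc01)] at h
    refine h.trans ?_
    simp_rw [hconst]
    refine liminf_le_of_le (by isBoundedDefault) fun b hb => ?_
    obtain ⟨m, hm⟩ := hb.exists
    refine hm.trans (hlt _ (hu m) ?_)
    have : 0 < 1 / ((m : ℝ) + 1) := by positivity
    nlinarith [hc01.1]
  refine ⟨c, hc01, f x, fun X => ?_⟩
  rw [hIν]
  constructor
  · intro h
    exact le_csSup hbdd ⟨hcap X, h⟩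
  · intro h
    exact (hf.mono (hcap X) (Set.Ioo_subset_Icc_self hc01) h).trans hfc

/-- Calibration: a loss `b + a 1_A` with `ν A = y` lands exactly on the threshold, and `a > 0`
allows `ν` to be compared afterwards. The scale `min c (1 - c)` keeps the loss within `[0,1]` for
every `y`. -/
theorem exists_affine_eq {c y : ℝ} (hc : c ∈ Set.Ioo (0 : ℝ) 1) (hy : y ∈ Set.Icc (0 : ℝ) 1) :
    ∃ b a : ℝ, 0 ≤ b ∧ 0 < a ∧ b + a ≤ 1 ∧ b + a * y = c := by
  refine ⟨c - min c (1 - c) * y, min c (1 - c), ?_, lt_min hc.1 (sub_pos.2 hc.2), ?_, by ring⟩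
  · nlinarith [min_le_left c (1 - c), lt_min hc.1 (sub_pos.2 hc.2), hy.1, hy.2]
  · nlinarith [min_le_right c (1 - c), lt_min hc.1 (sub_pos.2 hc.2), hy.1, hy.2]

variable [IsProbabilityMeasure P]

theorem Loss.step_identDistrib {b a : ℝ} (hb : 0 ≤ b) (ha : 0 ≤ a) (hba : b + a ≤ 1)
    {A B : Set Ω} (hA : MeasurableSet A) (hB : MeasurableSet B) (hAB : P.real A = P.real B) :
    IdentDistrib (Loss.step hb ha hba hA) (Loss.step hb ha hba hB) P P := by
  refine ⟨(Loss.step hb ha hba hA).2.1.aemeasurable, (Loss.step hb ha hba hB).2.1.aemeasurable, ?_⟩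
  have hAB' : P A = P B :=
    (ENNReal.toReal_eq_toReal_iff' (measure_ne_top _ _) (measure_ne_top _ _)).1 hAB
  classical
  ext S hS
  rw [Measure.map_apply (Loss.step hb ha hba hA).2.1 hS,
    Measure.map_apply (Loss.step hb ha hba hB).2.1 hS]
  have key : ∀ {C : Set Ω} (hC : MeasurableSet C), P ((Loss.step hb ha hba hC : Ω → ℝ) ⁻¹' S) =
      (if b + a ∈ S then P C else 0) + (if b ∈ S then P Cᶜ else 0) := by
    intro C hC
    have e : ∀ ω, (ω ∈ C ∧ Loss.step hb ha hba hC ω = b + a) ∨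
        (ω ∉ C ∧ Loss.step hb ha hba hC ω = b) := fun ω => by
      by_cases h : ω ∈ C <;> simp [Loss.step, h]
    rw [← measure_inter_add_sdiff _ hC]
    congr 1
    · split_ifs with h
      · congr 1
        ext ω
        rcases e ω with h' | h' <;> simp [h', h]
      · convert measure_empty (μ := P)
        ext ω
        rcases e ω with h' | h' <;> simp [h', h]
    · split_ifs with h
      · congr 1
        ext ω
        rcases e ω with h' | h' <;> simp [h', h]
      · convert measure_empty (μ := P)
        ext ω
        rcases e ω with h' | h' <;> simp [h', h]
  rw [key hA, key hB, hAB', prob_compl_eq_one_sub hA, prob_compl_eq_one_sub hB, hAB']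

/-- The loss on `A` calibrated to the threshold has the same law as the one on `B`, so the latter
cannot exceed the threshold. -/
theorem capacity_le_of_measureReal_eq {I : Loss Ω → ℕ} (hLI : LawInvariant P I)
    {ν : Set Ω → ℝ} (hν : IsCapacity ν) {c : ℝ} (hc : c ∈ Set.Ioo (0 : ℝ) 1) {k : ℕ}
    (hk : ∀ X : Loss Ω, I X ≤ k ↔ choquetIntegral ν X ≤ c) {A B : Set Ω} (hA : MeasurableSet A)
    (hB : MeasurableSet B) (hAB : P.real A = P.real B) : ν B ≤ ν A := by
  obtain ⟨b, a, hb, ha, hba, hbac⟩ := exists_affine_eq hc (hν.mem_Icc hA)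
  have h1 := hk (Loss.step hb ha.le hba hA)
  have h2 := hk (Loss.step hb ha.le hba hB)
  rw [choquetIntegral_step hν.empty hν.univ] at h1 h2
  rw [hLI _ _ (Loss.step_identDistrib hb ha.le hba hA hB hAB)] at h1
  have h3 := h2.1 (h1.2 hbac.le)
  rw [← hbac] at h3
  exact le_of_mul_le_mul_left (by linarith) ha

theorem exists_distortion {I : Loss Ω → ℕ} (hP : Atomless P) (hLI : LawInvariant P I)
    {ρ : BoundedRV Ω → ℝ} {ν : Set Ω → ℝ} (hν : IsCapacity ν)
    (hρ : ∀ X : BoundedRV Ω, ρ X = choquetIntegral ν X) {c : ℝ} (hc : c ∈ Set.Ioo (0 : ℝ) 1)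
    {k : ℕ} (hk : ∀ X : Loss Ω, I X ≤ k ↔ choquetIntegral ν X ≤ c) :
    ∃ h : ℝ → ℝ, IsDistortionFunction P h ρ ∧ ∀ A, MeasurableSet A → ν A = h (P.real A) := by
  classical
  -- The default 0 is never used on `[0,1]`, since every such value is the probability of some
  -- event.
  let h : ℝ → ℝ := fun t =>
    if H : ∃ A : Set Ω, MeasurableSet A ∧ P.real A = t then ν H.choose else 0
  have hh : ∀ A, MeasurableSet A → ν A = h (P.real A) := by
    intro A hA
    have H : ∃ B : Set Ω, MeasurableSet B ∧ P.real B = P.real A := ⟨A, hA, rfl⟩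
    simp only [h, H, dif_pos]
    exact (capacity_le_of_measureReal_eq hLI hν hc hk H.choose_spec.1 hA H.choose_spec.2).antisymm
      (capacity_le_of_measureReal_eq hLI hν hc hk hA H.choose_spec.1 H.choose_spec.2.symm)
  refine ⟨h, ⟨?_, ?_, ?_, ?_⟩, hh⟩
  · intro s hs t ht hst
    obtain ⟨D, hD, -, hDt⟩ := hP.exists_subset_measureReal_eq MeasurableSet.univ ht.1
      (by simpa using ht.2)
    obtain ⟨A, hA, hAD, hAs⟩ := hP.exists_subset_measureReal_eq hD hs.1 (hDt ▸ hst)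
    rw [← hDt, ← hAs, ← hh _ hA, ← hh _ hD]
    exact hν.mono _ _ hA hD hAD
  · have := hh ∅ MeasurableSet.empty
    rw [measureReal_empty, hν.empty] at this
    exact this.symm
  · have := hh Set.univ MeasurableSet.univ
    rw [probReal_univ, hν.univ] at this
    exact this.symm
  · intro X
    rw [hρ]
    have e : ∀ t : ℝ, ν {ω | t < X ω} = h (P.real {ω | t < X ω}) := fun t =>
      hh _ (measurableSet_lt measurable_const X.2.1)
    simp only [choquetIntegral, e]

/-- If `h ≤ y` on `[0, t)`, calibrate at `y` and remove ever smaller pieces from an event of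
probability `t`. The resulting losses stay below the threshold, and [LS] transfers this to the
limit, forcing `h t ≤ y`. -/
theorem distortion_left_continuous {I : Loss Ω → ℕ} (hP : Atomless P)
    (hLS : LowerSemicontinuousAS P I) {ν : Set Ω → ℝ} (hν : IsCapacity ν) {c : ℝ}
    (hc : c ∈ Set.Ioo (0 : ℝ) 1) {k : ℕ} (hk : ∀ X : Loss Ω, I X ≤ k ↔ choquetIntegral ν X ≤ c)
    {h : ℝ → ℝ} (hh : ∀ A, MeasurableSet A → ν A = h (P.real A))
    {t : ℝ} (ht : t ∈ Set.Ioc (0 : ℝ) 1) {y : ℝ} (hy : y < h t) :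
    ∃ s ∈ Set.Ico 0 t, y < h s := by
  by_contra! hcon
  obtain ⟨A, hA, -, hAt⟩ := hP.exists_subset_measureReal_eq (P := P) MeasurableSet.univ ht.1.le
    (by simpa using ht.2)
  have hy0 : 0 ≤ y := by
    have h1 := hcon 0 ⟨le_rfl, ht.1⟩
    have h2 := hh ∅ MeasurableSet.empty
    rw [measureReal_empty, hν.empty] at h2
    linarith
  have hy1 : y ≤ 1 := by
    have := (hν.mem_Icc hA).2
    rw [hh A hA, hAt] at this
    linarith
  have hpow : ∀ m : ℕ, 0 < (1 / 2 : ℝ) ^ m ∧ (1 / 2 : ℝ) ^ m ≤ 1 := fun m =>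
    ⟨by positivity, pow_le_one₀ (by norm_num) (by norm_num)⟩
  -- The pieces need not be nested: their masses are summable, so Borel–Cantelli gives almost sure
  -- convergence.
  choose C hC hCA hCt using fun m : ℕ => hP.exists_subset_measureReal_eq hA
    (t := t * (1 / 2 : ℝ) ^ m) (by have := ht.1; positivity)
    (by rw [hAt]; exact mul_le_of_le_one_right ht.1.le (hpow m).2)
  obtain ⟨b, a, hb, ha, hba, hbac⟩ := exists_affine_eq hc ⟨hy0, hy1⟩
  have hlow : ∀ m, I (Loss.step hb ha.le hba (hA.diff (hC m))) ≤ k := by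
    intro m
    rw [hk, choquetIntegral_step hν.empty hν.univ, hh _ (hA.diff (hC m)),
      measureReal_sdiff (hCA m) (hC m), hAt, hCt, ← hbac]
    have := mul_le_mul_of_nonneg_left (hcon (t - t * (1 / 2 : ℝ) ^ m)
      ⟨by nlinarith [hpow m, ht.1], by nlinarith [hpow m, ht.1]⟩) ha.le
    linarith
  have hsum : ∑' m, P (C m) ≠ ⊤ := by
    have e : ∀ m, P (C m) = ENNReal.ofReal (t * (1 / 2 : ℝ) ^ m) := fun m => by
      rw [← hCt m, Measure.real, ENNReal.ofReal_toReal (measure_ne_top _ _)]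
    simp_rw [e]
    exact (summable_geometric_two.mul_left t).tsum_ofReal_ne_top
  have hlim : ∀ᵐ ω ∂P, Tendsto (fun m => Loss.step hb ha.le hba (hA.diff (hC m)) ω) atTop
      (𝓝 (Loss.step hb ha.le hba hA ω)) := by
    filter_upwards [ae_eventually_notMem hsum] with ω hω
    refine tendsto_const_nhds.congr' ?_
    filter_upwards [hω] with m hm
    by_cases h : ω ∈ A <;> simp [Loss.step, h, hm]
  have hfin : I (Loss.step hb ha.le hba hA) ≤ k := by
    refine (hLS _ _ hlim).trans (liminf_le_of_le (by isBoundedDefault) fun b hb => ?_)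
    obtain ⟨m, hm⟩ := hb.exists
    exact hm.trans (hlow m)
  rw [hk, choquetIntegral_step hν.empty hν.univ, hh _ hA, hAt, ← hbac] at hfin
  have := mul_lt_mul_of_pos_left hy ha
  linarith

end Threshold

/-! ### Averaging conditionally iid losses forces concavity. -/

section MidpointConcavity

variable {Ω : Type*} [MeasurableSpace Ω] {P : Measure Ω}

theorem PoolingConsistent.le_of_average {I : Loss Ω → ℕ} (hI : PoolingConsistent P I)
    {L : ℕ → Loss Ω} (hL : CondIID P L) {W : Loss Ω} (hW : ∀ ω, W ω = (L 0 ω + L 1 ω) / 2) :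
    I W ≤ I (L 0) := by
  -- With attachment point 0 the tranche is the pool average itself.
  have h := hI L hL 1 2 le_rfl one_le_two ⟨0, le_rfl, zero_lt_one⟩
  have e1 : seniorTranche L ⟨0, le_rfl, zero_lt_one⟩ 1 = L 0 :=
    Subtype.ext (funext fun ω => by
      simp [seniorTranche, poolAverage, ((L 0).2.2 ω).1])
  have e2 : seniorTranche L ⟨0, le_rfl, zero_lt_one⟩ 2 = W :=
    Subtype.ext (funext fun ω => by
      have h1 := ((L 0).2.2 ω).1
      have h2 := ((L 1).2.2 ω).1
      rw [hW]
      have h3 : 0 ≤ (L 0 ω + L 1 ω) / 2 := by positivity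
      simp [seniorTranche, poolAverage, Finset.sum_range_succ, h3])
  rwa [e1, e2] at h

variable [IsProbabilityMeasure P]

/-- Conditionally iid Bernoulli events with prescribed probabilities of the intersection and of
the union of the first two. -/
theorem Atomless.exists_condIID_events (hP : Atomless P) {r η : ℝ} (hη : 0 ≤ η)
    (h0 : 2 * η ≤ r) (h1 : r + 2 * η ≤ 1) :
    ∃ (B : ℕ → Set Ω) (hB : ∀ i, MeasurableSet (B i)),
      P.real (B 0) = r ∧ P.real (B 0 ∩ B 1) = r - η ∧ P.real (B 0 ∪ B 1) = r + η ∧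
      ∀ {b a : ℝ} (hb : 0 ≤ b) (ha : 0 ≤ a) (hba : b + a ≤ 1),
        CondIID P fun i => Loss.step hb ha hba (hB i) := by
  classical
  -- Each event will contain `A`, of mass `r - 2 * η`, and on `D \ A`, of mass `4 * η`, be decided
  -- by its own coin. Two coins agree on heads on a mass `η`, whence `r - η` for the intersection.
  obtain ⟨D, hD, -, hDP⟩ := hP.exists_subset_measureReal_eq (P := P) (t := r + 2 * η)
    MeasurableSet.univ (by linarith) (by simpa using h1)
  obtain ⟨A, hA, hAD, hAP⟩ := hP.exists_subset_measureReal_eq (P := P) (t := r - 2 * η)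
    hD (by linarith) (by linarith)
  let π : Ω → Fin 3 := fun ω => if ω ∈ A then 2 else if ω ∈ D then 1 else 0
  have hπ : Measurable π := Measurable.ite hA measurable_const
    (Measurable.ite hD measurable_const measurable_const)
  have hπ2 : π ⁻¹' {2} = A := by
    ext ω
    by_cases hA' : ω ∈ A <;> by_cases hD' : ω ∈ D <;> simp [π, hA', hD']
  have hπ1 : π ⁻¹' {1} = D \ A := by
    ext ω
    by_cases hA' : ω ∈ A <;> by_cases hD' : ω ∈ D <;> simp [π, hA', hD']
  obtain ⟨ε, hε, hind⟩ := hP.exists_fair_coins hπ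
  have hm : ∀ i, MeasurableSet (ε i ⁻¹' {true}) := fun i => hε i (measurableSet_singleton _)
  let B : ℕ → Set Ω := fun i => A ∪ (D \ A ∩ ε i ⁻¹' {true})
  have hB : ∀ i, MeasurableSet (B i) := fun i => hA.union ((hD.diff hA).inter (hm i))
  have hdiff : P.real (D \ A) = 4 * η := by
    rw [measureReal_sdiff hAD hA, hDP, hAP]; ring
  have hcoin : coinProb {true} = 1 / 2 := by simp [coinProb]
  have hdisj : ∀ S : Set Ω, Disjoint A (D \ A ∩ S) := fun S =>
    Set.disjoint_sdiff_right.mono_right Set.inter_subset_left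
  have hone : ∀ i, P.real (B i) = r := by
    intro i
    have := hind {i} 1 fun _ => {true}
    simp only [Finset.mem_singleton, Set.iInter_iInter_eq_left, Finset.prod_singleton, hπ1, hdiff,
      hcoin] at this
    simp only [B]
    rw [measureReal_union (hdisj _) ((hD.diff hA).inter (hm i)), this, hAP]
    ring
  have hinter : P.real (B 0 ∩ B 1) = r - η := by
    have := hind {0, 1} 1 fun _ => {true}
    rw [Finset.set_biInter_insert, Finset.set_biInter_singleton, Finset.prod_pair zero_ne_one, hπ1,
      hdiff, hcoin] at this
    have hset : B 0 ∩ B 1 = A ∪ (D \ A ∩ (ε 0 ⁻¹' {true} ∩ ε 1 ⁻¹' {true})) := by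
      ext ω
      simp only [B, Set.mem_inter_iff, Set.mem_union]
      tauto
    rw [hset, measureReal_union (hdisj _) ((hD.diff hA).inter ((hm 0).inter (hm 1))), this, hAP]
    ring
  have hunion : P.real (B 0 ∪ B 1) = r + η := by
    have := measureReal_union_add_inter (μ := P) (s := B 0) (hB 1)
    rw [hinter, hone, hone] at this
    linarith
  refine ⟨B, hB, hone 0, hinter, hunion, fun {b a} hb ha hba => ?_⟩
  refine condIID_of_coins hπ hind
    (fun z e => b + a * if z = 2 ∨ (z = 1 ∧ e = true) then 1 else 0) _ fun i ω => ?_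
  change b + a * (B i).indicator 1 ω = _
  congr 2
  have h2 : π ω = 2 ↔ ω ∈ A := by rw [← hπ2]; rfl
  have h1' : π ω = 1 ↔ ω ∈ D \ A := by rw [← hπ1]; rfl
  rw [Set.indicator_apply]
  exact if_congr (by rw [h2, h1']; rfl) rfl rfl

theorem CondIID.identDistrib {L : ℕ → Loss Ω} (hL : CondIID P L) (i j : ℕ) :
    IdentDistrib (L i) (L j) P P := by
  obtain ⟨d, Z, hZ⟩ := hL
  refine ⟨(L i).2.1.aemeasurable, (L j).2.1.aemeasurable, ?_⟩
  have h := hZ.map_eq (m := 1) (σ := fun _ => i) (τ := fun _ => j)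
    (Function.injective_of_subsingleton _) (Function.injective_of_subsingleton _)
  have e : ∀ i, (P.map fun ω (_ : Fin 1) => L i ω).map (fun x => x 0) = P.map (L i) := fun i => by
    rw [Measure.map_map (measurable_pi_apply 0) (measurable_pi_lambda _ fun _ => (L i).2.1)]
    rfl
  rw [← e i, ← e j, h]

/-- `hmix` is the common consequence of [QC] with [LI] and of [PE]. The average of two calibrated
losses on `B 0` and `B 1` is a two-step loss on their intersection and union, so staying below the
threshold is the midpoint inequality. -/
theorem distortion_concaveOn {I : Loss Ω → ℕ} (hP : Atomless P)
    (hLS : LowerSemicontinuousAS P I) {ν : Set Ω → ℝ} (hν : IsCapacity ν) {c : ℝ}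
    (hc : c ∈ Set.Ioo (0 : ℝ) 1) {k : ℕ} (hk : ∀ X : Loss Ω, I X ≤ k ↔ choquetIntegral ν X ≤ c)
    {h : ℝ → ℝ} (hmono : MonotoneOn h (Set.Icc 0 1))
    (hh : ∀ A, MeasurableSet A → ν A = h (P.real A))
    (hmix : ∀ L : ℕ → Loss Ω, CondIID P L → ∀ W : Loss Ω,
      (∀ ω, W ω = (L 0 ω + L 1 ω) / 2) → I W ≤ I (L 0)) :
    ConcaveOn ℝ (Set.Icc 0 1) h := by
  refine concaveOn_of_local_midpoint hmono
    (fun t ht y hy => distortion_left_continuous hP hLS hν hc hk hh ht hy) fun r hr δ hδ => ?_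
  -- The factor 2 leaves room for the sets of mass `r - 2 * η` and `r + 2 * η`.
  set η : ℝ := min δ (min r (1 - r)) / 2 with hη
  have hpos : 0 < min δ (min r (1 - r)) := lt_min hδ (lt_min hr.1 (sub_pos.2 hr.2))
  have e1 : min δ (min r (1 - r)) ≤ δ := min_le_left _ _
  have e2 : min δ (min r (1 - r)) ≤ r := (min_le_right _ _).trans (min_le_left _ _)
  have e3 : min δ (min r (1 - r)) ≤ 1 - r := (min_le_right _ _).trans (min_le_right _ _)
  refine ⟨η, ⟨by linarith, by linarith⟩, ?_⟩
  obtain ⟨B, hB, hB0, hBi, hBu, hBc⟩ := hP.exists_condIID_events (P := P) (r := r) (η := η)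
    (by linarith) (by linarith) (by linarith)
  obtain ⟨b, a, hb, ha, hba, hbac⟩ := exists_affine_eq hc (hν.mem_Icc (hB 0))
  let L : ℕ → Loss Ω := fun i => Loss.step hb ha.le hba (hB i)
  let W : Loss Ω := Loss.mix ⟨1 / 2, by norm_num, by norm_num⟩ (L 0) (L 1)
  have hW : ∀ ω, W ω = (L 0 ω + L 1 ω) / 2 := fun ω => by
    simp only [W, Loss.mix]; ring
  have hWν : choquetIntegral ν W = b + a / 2 * ν (B 0 ∩ B 1) + a / 2 * ν (B 0 ∪ B 1) := by
    refine choquetIntegral_two_step hν.empty hν.univ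
      (Set.inter_subset_left.trans Set.subset_union_left) hb (by linarith) (by linarith)
      (by linarith) W fun ω => ?_
    rw [hW]
    simp only [L, Loss.step]
    by_cases h0 : ω ∈ B 0 <;> by_cases h1 : ω ∈ B 1 <;> simp [h0, h1] <;> ring
  have hL0 : I (L 0) ≤ k := by
    rw [hk, choquetIntegral_step hν.empty hν.univ]; exact hbac.le
  have hfin := (hk W).1 ((hmix L (hBc hb ha.le hba) W hW).trans hL0)
  rw [hWν, ← hbac, hh _ ((hB 0).inter (hB 1)), hh _ ((hB 0).union (hB 1)), hh _ (hB 0), hBi, hBu,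
    hB0] at hfin
  refine le_of_mul_le_mul_left ?_ ha
  linarith

theorem QuasiConvex.le_of_average {I : Loss Ω → ℕ} (hI : QuasiConvex I) (hLI : LawInvariant P I)
    {L : ℕ → Loss Ω} (hL : CondIID P L) {W : Loss Ω} (hW : ∀ ω, W ω = (L 0 ω + L 1 ω) / 2) :
    I W ≤ I (L 0) := by
  have e : W = Loss.mix ⟨1 / 2, by norm_num, by norm_num⟩ (L 0) (L 1) :=
    Subtype.ext (funext fun ω => by rw [hW]; simp only [Loss.mix]; ring)
  have h := hI (L 0) (L 1) ⟨1 / 2, by norm_num, by norm_num⟩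
  rwa [← e, hLI _ _ (hL.identDistrib 1 0), max_self] at h

end MidpointConcavity

end ChoquetRating

/-! ### The equivalence. -/

theorem proposition2 {Ω : Type*} [MeasurableSpace Ω] (P : Measure Ω) [IsProbabilityMeasure P]
    (hP : ChoquetRating.Atomless P) (n : ℕ) (I : ChoquetRating.Loss Ω → ℕ)
    (ρ : ChoquetRating.BoundedRV Ω → ℝ)
    (hI : ChoquetRating.IsChoquetRatingCriterion n I ρ)
    (hLS : ChoquetRating.LowerSemicontinuousAS P I)
    (hLI : ChoquetRating.LawInvariant P I) :
    List.TFAE [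
      ChoquetRating.QuasiConvex I,
      ChoquetRating.RiskAverse P I,
      ChoquetRating.PoolingConsistent P I,
      ∃ h : ℝ → ℝ, ChoquetRating.IsDistortionFunction P h ρ ∧
        ConcaveOn ℝ (Set.Icc 0 1) h] := by
  open ChoquetRating in
  obtain ⟨ν, hν, hρ⟩ := hI.2.1
  obtain ⟨c, hc, k, hk⟩ := exists_threshold hI hLS hν hρ
  obtain ⟨h, hh, hhν⟩ := exists_distortion hP hLI hν hρ hc hk
  obtain ⟨-, -, f, hf, -, hIf⟩ := hI
  have hρ01 : ∀ X : Loss Ω, ρ X.toBounded ∈ Set.Icc (0 : ℝ) 1 := fun X => by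
    rw [hρ]; exact hν.choquetIntegral_mem_Icc X
  tfae_have 1 → 4 := fun hQC => ⟨h, hh, distortion_concaveOn hP hLS hν hc hk hh.mono hhν
    fun L hL W hW => hQC.le_of_average hLI hL hW⟩
  tfae_have 3 → 4 := fun hPE => ⟨h, hh, distortion_concaveOn hP hLS hν hc hk hh.mono hhν
    fun L hL W hW => hPE.le_of_average hL hW⟩
  tfae_have 2 → 3 := fun hRA => hRA.poolingConsistent
  tfae_have 4 → 2 := by
    rintro ⟨g, hg, hgc⟩ X Y hXY
    rw [hIf, hIf]
    exact hf.mono (hρ01 X) (hρ01 Y) (hg.le_of_icxLE hgc hXY)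
  tfae_have 4 → 1 := by
    rintro ⟨g, hg, hgc⟩ X Y s
    -- A monotone `f` commutes with `max`, so quasi-convexity of `ρ`, a consequence of its
    -- convexity, is enough.
    rw [hIf, hIf, hIf, ← hf.mono.map_max (hρ01 X) (hρ01 Y)]
    refine hf.mono (hρ01 _) ⟨(hρ01 X).1.trans (le_max_left _ _),
      max_le (hρ01 X).2 (hρ01 Y).2⟩ ((hg.mix_le hgc s X Y).trans ?_)
    have h0 : (0 : ℝ) ≤ s := s.2.1
    have h1 : (0 : ℝ) ≤ 1 - s := sub_nonneg.2 s.2.2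
    have h2 := mul_le_mul_of_nonneg_left (le_max_left (ρ X.toBounded) (ρ Y.toBounded)) h0
    have h3 := mul_le_mul_of_nonneg_left (le_max_right (ρ X.toBounded) (ρ Y.toBounded)) h1
    linarith
  tfae_finish
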